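/- **Theorem (Semiclassical pseudomodes).** Let $n\ge 0$ and let $a_0,\dots,a_n:\mathbb R\to\mathbb C$ be real-analytic functions on $\mathbb R$. For $h>0$ consider the semiclassical differential operator $$H_h=\sum_{j=0}^n a_j(x)\,h^j\,\frac{d^j}{dx^j},\qquad \operatorname{Dom}(H_h)=C_0^\infty(\mathbb R),$$ and its symbol $$f(x,\xi)=\sum_{j=0}^n a_j(x)\,(i\xi)^j,\qquad (x,\xi)\in\mathbb R^2 .$$ With the Poisson bracket $\{u,v\}=\partial_\xi u\,\partial_x v-\partial_x u\,\partial_\xi v$, put $$\Lambda=\Big\{f(x,\xi)\;:\;(x,\xi)\in\mathbb R^2,\ \tfrac1{2i}\{f,\bar f\}(x,\xi)>0\Big\}.$$ Let $\|\cdot\|$ be the norm of $L^2(\mathbb R)$. 1. For every $z\in\Lambda$ there exist $C=C(z)>1$, $h_0=h_0(z)>0$ and functions $\psi_h\in C_0^\infty(\mathbb R)$, $0<h\le h_0$, such that $$\|(H_h-z)\psi_h\|<C^{-1/h}\,\|\psi_h\|\qquad\text{for all }0<h\le h_0 .$$ 2. The constants can be chosen uniformly on compact subsets of $\Lambda$: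 for every compact $K\subseteq\Lambda$ there exist $C=C(K)>1$ and $h_0=h_0(K)>0$ such that for every $z\in K$ there are functions $\psi_h\in C_0^\infty(\mathbb R)$, $0<h\le h_0$, with $\|(H_h-z)\psi_h\|<C^{-1/h}\|\psi_h\|$ for all $0<h\le h_0$. In particular both parts hold for Schrödinger operators $H_h=-h^2\frac{d^2}{dx^2}+V(x)$ with $V:\mathbb R\to\mathbb C$ analytic, whose symbol is $f(x,\xi)=\xi^2+V(x)$. -/

import Mathlib

open scoped ContDiff

noncomputable section

/-- `C_0^∞(ℝ)`: smooth complex-valued functions on the line with compact support. -/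
def IsTestFunction (ψ : ℝ → ℂ) : Prop :=
  ContDiff ℝ ∞ ψ ∧ HasCompactSupport ψ

/-- The symbol `f(x, ξ) = ∑_{j ≤ n} a_j(x) (iξ)^j`
(the derivative `h d/dx` corresponds to `iξ`, as in `h d/dx e^{ixξ/h} = iξ e^{ixξ/h}`). -/
def semiclassicalSymbol {n : ℕ} (a : Fin (n + 1) → ℝ → ℂ) (x ξ : ℝ) : ℂ :=
  ∑ j, a j x * (Complex.I * (ξ : ℂ)) ^ (j : ℕ)

/-- The semiclassical differential operator `H_h = ∑_{j ≤ n} a_j(x) h^j d^j/dx^j`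
applied to `ψ` (used on test functions). -/
def semiclassicalOp {n : ℕ} (a : Fin (n + 1) → ℝ → ℂ) (h : ℝ) (ψ : ℝ → ℂ) (x : ℝ) : ℂ :=
  ∑ j, a j x * (h : ℂ) ^ (j : ℕ) * iteratedDeriv (j : ℕ) ψ x

/-- The Poisson bracket `{u, v} = ∂_ξ u ∂_x v - ∂_x u ∂_ξ v` of functions of `(x, ξ)`. -/
def poissonBracket (u v : ℝ → ℝ → ℂ) (x ξ : ℝ) : ℂ :=
  deriv (fun η => u x η) ξ * deriv (fun y => v y ξ) x
    - deriv (fun y => u y ξ) x * deriv (fun η => v x η) ξ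

/-- The real number `{f, f̄}(x, ξ) / (2i)`. -/
def halfBracket (f : ℝ → ℝ → ℂ) (x ξ : ℝ) : ℝ :=
  (1 / (2 * Complex.I) * poissonBracket f (fun y η => starRingEnd ℂ (f y η)) x ξ).re

/-- Taking the real part in `halfBracket` loses nothing. -/
theorem ofReal_halfBracket (f : ℝ → ℝ → ℂ) (x ξ : ℝ) :
    (halfBracket f x ξ : ℂ)
      = 1 / (2 * Complex.I) * poissonBracket f (fun y η => starRingEnd ℂ (f y η)) x ξ := by
  have h1 : deriv (fun y => starRingEnd ℂ (f y ξ)) x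
      = starRingEnd ℂ (deriv (fun y => f y ξ) x) := deriv.star
  have h2 : deriv (fun η => starRingEnd ℂ (f x η)) ξ
      = starRingEnd ℂ (deriv (fun η => f x η) ξ) := deriv.star
  apply Complex.ext
  · simp [halfBracket]
  · rw [Complex.ofReal_im]
    simp only [poissonBracket, h1, h2]
    simp
    ring

/-- The set `Λ` of the values of the symbol at the points where `{f, f̄}/(2i) > 0`. -/
def pseudospectrumCore {n : ℕ} (a : Fin (n + 1) → ℝ → ℂ) : Set ℂ :=
  {z | ∃ x ξ : ℝ, 0 < halfBracket (semiclassicalSymbol a) x ξ ∧ semiclassicalSymbol a x ξ = z}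

/-- `ψ` is a family of pseudomodes for `H_h` and `z`: for all `0 < h ≤ h₀` the function `ψ h` is a
test function with `‖(H_h - z) ψ_h‖ < C^{-1/h} ‖ψ_h‖` in `L²(ℝ)`. -/
def IsPseudomodeFamily {n : ℕ} (a : Fin (n + 1) → ℝ → ℂ) (z : ℂ) (C h₀ : ℝ)
    (ψ : ℝ → ℝ → ℂ) : Prop :=
  ∀ h : ℝ, 0 < h → h ≤ h₀ → IsTestFunction (ψ h) ∧
    MeasureTheory.eLpNorm (fun x => semiclassicalOp a h (ψ h) x - z * ψ h x) 2
        MeasureTheory.volume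
      < ENNReal.ofReal (C ^ (-1 / h)) * MeasureTheory.eLpNorm (ψ h) 2 MeasureTheory.volume

end

open Metric Filter Topology
open scoped ContDiff

/-! This is the complex WKB method with exponentially accurate amplitudes. Extend the coefficients
holomorphically near `x₀` and solve the eikonal equation `∑ b_j g ^ j = z` with `g x₀ = iξ₀`
(`exists_holomorphic_root`). A positive bracket makes the root simple and is equivalent to `Re
g'(x₀) < 0`. As `Re g(x₀) = 0`, the primitive `Φ` of `g` has real part at most `-κ (x - x₀) ^ 2` on
the line (`exists_re_phase_le`), so `exp (Φ / h)` concentrates at `x₀`.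

Conjugation by `exp (Φ / h)` turns `H_h - z` into `h` times a transport operator plus a remainder.
Summing `v_0 + ... + v_N`, where each term solves the transport equation with the previous remainder
as source, leaves only the remainder of `v_N`. Cauchy estimates show that every iteration gains a
factor 1/4 and shrinks the disc by `O(h)`. Hence `N ~ γ / h` iterations are possible, with error
`exp (-γ / h)` (`exists_wkb_amplitude`).

The pseudomode is this function times a cutoff: where the cutoff varies, the phase is exponentially
small. For `z` near `z₀` the base point `x₀` is kept and only the root `g` moves. This changes `Re
Φ` by little, which the exponential gains absorb, so the constants are locally uniform
(`exists_pseudomodes_near`) and compactness finishes. -/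

/-- The operator `h d/dx` conjugated with `exp (Φ / h)`, where `Φ' = g`. -/
noncomputable def conjDeriv (h : ℂ) (g u : ℂ → ℂ) : ℂ → ℂ := fun x => h * deriv u x + g x * u x

/-- The part of `((h d/dx + g) ^ j u - g ^ j u) / h` besides the transport term
`j g ^ (j - 1) u'`. -/
noncomputable def wkbRemainder (h : ℂ) (g u : ℂ → ℂ) : ℕ → ℂ → ℂ
  | 0 => 0
  | j + 1 => fun x => deriv (fun y => g y ^ j) x * u x + g x * wkbRemainder h g u j x
      + h * deriv (fun y => j * g y ^ (j - 1) * deriv u y + wkbRemainder h g u j y) x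

/-! ### Conjugation by the exponential and the exact remainder -/

section Algebra

variable {h : ℂ} {g u : ℂ → ℂ} {s : Set ℂ}

theorem differentiableOn_wkbRemainder (hs : IsOpen s) (hg : DifferentiableOn ℂ g s)
    (hu : DifferentiableOn ℂ u s) (j : ℕ) : DifferentiableOn ℂ (wkbRemainder h g u j) s := by
  induction j with
  | zero => exact differentiableOn_const 0
  | succ j ih =>
    have h1 := (hg.pow j).deriv hs
    have h2 : DifferentiableOn ℂ
        (fun y => j * g y ^ (j - 1) * deriv u y + wkbRemainder h g u j y) s :=
      (((hg.pow (j - 1)).const_mul (j : ℂ)).mul (hu.deriv hs)).add ih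
    exact ((h1.mul hu).add (hg.mul ih)).add ((h2.deriv hs).const_mul h)

theorem differentiableOn_conjDeriv_iterate (hs : IsOpen s) (hg : DifferentiableOn ℂ g s)
    (hu : DifferentiableOn ℂ u s) (j : ℕ) : DifferentiableOn ℂ ((conjDeriv h g)^[j] u) s := by
  induction j with
  | zero => exact hu
  | succ j ih =>
    rw [Function.iterate_succ_apply']
    exact ((ih.deriv hs).const_mul h).add (hg.mul ih)

/-- The identity is exact, not asymptotic: the recursion for `wkbRemainder` collects all that one
further application of `h d/dx + g` produces beyond the eikonal and transport terms. -/
theorem conjDeriv_iterate_eq (hs : IsOpen s) (hg : DifferentiableOn ℂ g s)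
    (hu : DifferentiableOn ℂ u s) (j : ℕ) :
    ∀ x ∈ s, (conjDeriv h g)^[j] u x
      = g x ^ j * u x + h * (j * g x ^ (j - 1) * deriv u x + wkbRemainder h g u j x) := by
  induction j with
  | zero => intro x _; simp [wkbRemainder]
  | succ j ih =>
    intro x hx
    have hsx := hs.mem_nhds hx
    have hev : (conjDeriv h g)^[j] u =ᶠ[nhds x] fun x => g x ^ j * u x
        + h * (j * g x ^ (j - 1) * deriv u x + wkbRemainder h g u j x) :=
      Filter.eventuallyEq_of_mem hsx ih
    have d1 : DifferentiableAt ℂ (fun y => g y ^ j) x := (hg.pow j).differentiableAt hsx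
    have d2 : DifferentiableAt ℂ u x := hu.differentiableAt hsx
    have d3 : DifferentiableAt ℂ
        (fun y => j * g y ^ (j - 1) * deriv u y + wkbRemainder h g u j y) x :=
      ((((hg.pow (j - 1)).const_mul (j : ℂ)).mul (hu.deriv hs)).add
        (differentiableOn_wkbRemainder hs hg hu j)).differentiableAt hsx
    rw [Function.iterate_succ_apply', conjDeriv, ih x hx, hev.deriv_eq]
    rw [deriv_fun_add (d1.fun_mul d2) (d3.const_mul h), deriv_fun_mul d1 d2, deriv_const_mul _ d3]
    simp only [wkbRemainder]
    rcases j with _ | j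
    · simp; ring
    · simp only [Nat.add_sub_cancel]
      push_cast
      ring

theorem conjDeriv_iterate_sum (hs : IsOpen s) (hg : DifferentiableOn ℂ g s) {v : ℕ → ℂ → ℂ}
    (hv : ∀ k, DifferentiableOn ℂ (v k) s) (N j : ℕ) :
    ∀ x ∈ s, (conjDeriv h g)^[j] (fun y => ∑ k ∈ Finset.range N, v k y) x
      = ∑ k ∈ Finset.range N, (conjDeriv h g)^[j] (v k) x := by
  induction j with
  | zero => intro x _; rfl
  | succ j ih =>
    intro x hx
    have hsx := hs.mem_nhds hx
    simp only [Function.iterate_succ_apply']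
    rw [conjDeriv, (Filter.eventuallyEq_of_mem hsx ih).deriv_eq, ih x hx, deriv_fun_sum fun k _ =>
      (differentiableOn_conjDeriv_iterate hs hg (hv k) j).differentiableAt hsx]
    simp only [conjDeriv, Finset.sum_add_distrib, Finset.mul_sum]

theorem iteratedDeriv_exp_mul {Φ : ℂ → ℂ} (hh : h ≠ 0) (hs : IsOpen s)
    (hΦ : ∀ x ∈ s, HasDerivAt Φ (g x) x) (hg : DifferentiableOn ℂ g s)
    (hu : DifferentiableOn ℂ u s) (j : ℕ) :
    ∀ x ∈ s, h ^ j * iteratedDeriv j (fun y => Complex.exp (Φ y / h) * u y) x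
      = Complex.exp (Φ x / h) * (conjDeriv h g)^[j] u x := by
  induction j with
  | zero => intro x _; simp
  | succ j ih =>
    intro x hx
    have hsx := hs.mem_nhds hx
    have hev : iteratedDeriv j (fun y => Complex.exp (Φ y / h) * u y) =ᶠ[nhds x]
        fun y => (h ^ j)⁻¹ * (Complex.exp (Φ y / h) * (conjDeriv h g)^[j] u y) :=
      Filter.eventuallyEq_of_mem hsx fun y hy => by
        rw [← ih y hy, inv_mul_cancel_left₀ (pow_ne_zero j hh)]
    have hd := ((((hΦ x hx).div_const h).cexp.mul
      ((differentiableOn_conjDeriv_iterate hs hg hu (h := h) j).differentiableAt hsx).hasDerivAt).const_mul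
        (h ^ j)⁻¹).deriv
    rw [iteratedDeriv_succ, hev.deriv_eq, Function.iterate_succ_apply', conjDeriv]
    refine (congrArg _ hd).trans ?_
    field_simp
    ring

end Algebra

/-! ### Cauchy estimates for the remainder -/

section Bounds

theorem norm_iteratedDeriv_le_of_closedBall_subset {f : ℂ → ℂ} {U : Set ℂ} {x : ℂ} {η C : ℝ}
    (hη : 0 < η) (hf : DifferentiableOn ℂ f U) (hU : closedBall x η ⊆ U)
    (hC : ∀ y ∈ closedBall x η, ‖f y‖ ≤ C) (n : ℕ) :
    ‖iteratedDeriv n f x‖ ≤ n.factorial * C / η ^ n := by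
  refine Complex.norm_iteratedDeriv_le_of_forall_mem_sphere_norm_le n hη
    (DifferentiableOn.diffContOnCl ?_) fun y hy => hC y (sphere_subset_closedBall hy)
  exact hf.mono (closure_ball_subset_closedBall.trans hU)

theorem norm_deriv_le_of_ball {f : ℂ → ℂ} {x₀ : ℂ} {ρ η C : ℝ} (hη : 0 < η)
    (hf : DifferentiableOn ℂ f (ball x₀ ρ)) (hC : ∀ y ∈ ball x₀ ρ, ‖f y‖ ≤ C) :
    ∀ x ∈ ball x₀ (ρ - η), ‖deriv f x‖ ≤ C / η := by
  intro x hx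
  have hsub : closedBall x η ⊆ ball x₀ ρ :=
    closedBall_subset_ball' (by rw [mem_ball] at hx; linarith)
  simpa using norm_iteratedDeriv_le_of_closedBall_subset hη hf hsub
    (fun y hy => hC y (hsub hy)) 1

/-- The constants in the bounds for `wkbRemainder` on a disc where `‖g‖ ≤ M`, when `g` is
holomorphic and bounded by `M` on a disc with radius larger by `R`. -/
noncomputable def wkbConst (M R : ℝ) : ℕ → ℝ
  | 0 => 0
  | j + 1 => M ^ j / R + M * wkbConst M R j + (j * M ^ (j - 1) + wkbConst M R j)

theorem wkbConst_nonneg {M R : ℝ} (hM : 0 ≤ M) (hR : 0 < R) (j : ℕ) : 0 ≤ wkbConst M R j := by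
  induction j with
  | zero => exact le_rfl
  | succ j ih => simp only [wkbConst]; positivity

/-- Each differentiation in the recursion costs `1 / η` by Cauchy on a disc smaller by `η`, but it
carries a factor `h ≤ θ * η`. The constants therefore depend on neither `h` nor `η`, and `u'` enters
only with the small weight `θ`. -/
theorem norm_wkbRemainder_le {x₀ : ℂ} {M R ρ η θ h m₀ m₁ : ℝ} {g u : ℂ → ℂ} (hM : 0 ≤ M)
    (hR : 0 < R) (hρ : ρ ≤ R) (hη : 0 < η) (hh : 0 ≤ h) (hθ : θ ≤ 1) (hhη : h ≤ θ * η)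
    (hg : DifferentiableOn ℂ g (ball x₀ (2 * R))) (hgM : ∀ x ∈ ball x₀ (2 * R), ‖g x‖ ≤ M)
    (hu : DifferentiableOn ℂ u (ball x₀ ρ)) (hu₀ : ∀ x ∈ ball x₀ ρ, ‖u x‖ ≤ m₀)
    (hu₁ : ∀ x ∈ ball x₀ ρ, ‖deriv u x‖ ≤ m₁) (hm₀ : 0 ≤ m₀) (hm₁ : 0 ≤ m₁) (j : ℕ) :
    ∀ x ∈ ball x₀ (ρ - j * η), ‖wkbRemainder h g u j x‖ ≤ wkbConst M R j * (m₀ + θ * m₁) := by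
  have hθ0 : 0 ≤ θ := by
    by_contra hc
    nlinarith
  have hK := wkbConst_nonneg hM hR
  have hsub : ball x₀ ρ ⊆ ball x₀ (2 * R) := ball_subset_ball (by linarith)
  induction j with
  | zero => intro x _; simp [wkbRemainder, wkbConst]
  | succ j ih =>
    have hρj : ball x₀ (ρ - j * η) ⊆ ball x₀ ρ :=
      ball_subset_ball (by have : 0 ≤ j * η := by positivity
                           linarith)
    intro x hx
    have hx' : x ∈ ball x₀ (ρ - j * η - η) := by
      convert hx using 2; push_cast; ring
    have hxj : x ∈ ball x₀ (ρ - j * η) := ball_subset_ball (by linarith) hx'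
    have hxρ := hρj hxj
    -- Since `ρ ≤ R`, Cauchy for powers of `g` can use the fixed margin `R` instead of `η`.
    have b1 : ‖deriv (fun y => g y ^ j) x‖ ≤ M ^ j / R := by
      refine norm_deriv_le_of_ball hR (hg.pow j) (fun y hy => ?_) x
        (ball_subset_ball (by linarith) hxρ)
      rw [Pi.pow_apply, norm_pow]
      exact pow_le_pow_left₀ (norm_nonneg _) (hgM y hy) j
    have b2 : ‖deriv (fun y => j * g y ^ (j - 1) * deriv u y + wkbRemainder h g u j y) x‖
        ≤ (j * M ^ (j - 1) * m₁ + wkbConst M R j * (m₀ + θ * m₁)) / η := by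
      refine norm_deriv_le_of_ball hη ?_ (fun y hy => ?_) x hx'
      · have hg' := hg.mono hsub
        exact ((((hg'.pow (j - 1)).const_mul (j : ℂ)).mul (hu.deriv isOpen_ball)).add
          (differentiableOn_wkbRemainder isOpen_ball hg' hu j)).mono hρj
      · refine (norm_add_le _ _).trans (add_le_add ?_ (ih y hy))
        rw [norm_mul, norm_mul, norm_pow, Complex.norm_natCast]
        have := hgM y (hsub (hρj hy))
        have := hu₁ y (hρj hy)
        gcongr
    have b3 := ih x hxj
    have b4 := hgM x (hsub hxρ)
    have b5 := hu₀ x hxρ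
    have hKj := hK j
    have e : h * ((j * M ^ (j - 1) * m₁ + wkbConst M R j * (m₀ + θ * m₁)) / η)
        ≤ j * M ^ (j - 1) * (θ * m₁) + wkbConst M R j * (m₀ + θ * m₁) := by
      have h1 : h / η ≤ θ := (div_le_iff₀ hη).2 hhη
      have h2 : h / η ≤ 1 := h1.trans hθ
      calc _ = j * M ^ (j - 1) * (h / η * m₁) + h / η * (wkbConst M R j * (m₀ + θ * m₁)) := by ring
        _ ≤ j * M ^ (j - 1) * (θ * m₁) + 1 * (wkbConst M R j * (m₀ + θ * m₁)) := by gcongr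
        _ = _ := by ring
    calc ‖wkbRemainder h g u (j + 1) x‖
        ≤ ‖deriv (fun y => g y ^ j) x‖ * ‖u x‖ + ‖g x‖ * ‖wkbRemainder h g u j x‖
          + h * ‖deriv (fun y => j * g y ^ (j - 1) * deriv u y + wkbRemainder h g u j y) x‖ := by
          simp only [wkbRemainder]
          refine (norm_add₃_le).trans ?_
          simp only [norm_mul, Complex.norm_real, Real.norm_of_nonneg hh, le_refl]
      _ ≤ M ^ j / R * m₀ + M * (wkbConst M R j * (m₀ + θ * m₁))
          + (j * M ^ (j - 1) * (θ * m₁) + wkbConst M R j * (m₀ + θ * m₁)) := by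
          refine add_le_add (add_le_add ?_ ?_) (le_trans (by gcongr) e) <;> gcongr
      _ ≤ M ^ j / R * (m₀ + θ * m₁) + M * (wkbConst M R j * (m₀ + θ * m₁))
          + (j * M ^ (j - 1) * (m₀ + θ * m₁) + wkbConst M R j * (m₀ + θ * m₁)) := by
          have h3 : 0 ≤ θ * m₁ := by positivity
          gcongr <;> linarith
      _ = _ := by simp only [wkbConst]; ring

end Bounds

/-! ### Transport equations and the exponentially accurate amplitude -/

section Amplitude

variable {n : ℕ} {x₀ : ℂ} {M R r c₀ θ η h : ℝ} {b : Fin (n + 1) → ℂ → ℂ} {g : ℂ → ℂ}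

/-- The coefficient of `h d/dx` in the conjugated operator `∑ b_j (h d/dx + g) ^ j`. -/
def transportCoeff (b : Fin (n + 1) → ℂ → ℂ) (g : ℂ → ℂ) (x : ℂ) : ℂ :=
  ∑ j, b j x * ((j : ℕ) * g x ^ ((j : ℕ) - 1))

/-- The conjugated operator `∑ b_j (h d/dx + g) ^ j`, divided by `h`, without its terms of
order zero in `h` and its transport term. -/
noncomputable def totalRemainder (b : Fin (n + 1) → ℂ → ℂ) (h : ℂ) (g v : ℂ → ℂ) (x : ℂ) : ℂ :=
  ∑ j, b j x * wkbRemainder h g v j x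

/-- The constant in the bound for `totalRemainder`. -/
noncomputable def totalConst (n : ℕ) (M R : ℝ) : ℝ := ∑ j : Fin (n + 1), M * wkbConst M R j

theorem totalConst_nonneg (hM : 0 ≤ M) (hR : 0 < R) : 0 ≤ totalConst n M R :=
  Finset.sum_nonneg fun j _ => mul_nonneg hM (wkbConst_nonneg hM hR j)

theorem norm_totalRemainder_le {ρ m₀ m₁ : ℝ} {v : ℂ → ℂ} (hM : 0 ≤ M)
    (hR : 0 < R) (hρ : ρ ≤ R) (hη : 0 < η) (hh : 0 ≤ h) (hθ : θ ≤ 1) (hhη : h ≤ θ * η)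
    (hbM : ∀ j, ∀ x ∈ ball x₀ (2 * R), ‖b j x‖ ≤ M)
    (hg : DifferentiableOn ℂ g (ball x₀ (2 * R))) (hgM : ∀ x ∈ ball x₀ (2 * R), ‖g x‖ ≤ M)
    (hv : DifferentiableOn ℂ v (ball x₀ ρ)) (hv₀ : ∀ x ∈ ball x₀ ρ, ‖v x‖ ≤ m₀)
    (hv₁ : ∀ x ∈ ball x₀ ρ, ‖deriv v x‖ ≤ m₁) (hm₀ : 0 ≤ m₀) (hm₁ : 0 ≤ m₁) :
    ∀ x ∈ ball x₀ (ρ - (n + 1) * η),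
      ‖totalRemainder b h g v x‖ ≤ totalConst n M R * (m₀ + θ * m₁) := by
  intro x hx
  rw [totalRemainder, totalConst, Finset.sum_mul]
  refine norm_sum_le_of_le _ fun j _ => ?_
  have hj : ((j : ℕ) : ℝ) ≤ n + 1 := by exact_mod_cast j.2.le
  have h1 := norm_wkbRemainder_le hM hR hρ hη hh hθ hhη hg hgM hv hv₀ hv₁ hm₀ hm₁ j x
    (ball_subset_ball (by gcongr) hx)
  have h2 := hbM j x (ball_subset_ball (by
    have : 0 ≤ (n + 1 : ℝ) * η := by positivity
    linarith) hx)
  rw [norm_mul, mul_assoc]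
  gcongr

theorem exists_transport_solution (hc : ∀ x ∈ ball x₀ r, transportCoeff b g x ≠ 0)
    (hb : ∀ j, DifferentiableOn ℂ (b j) (ball x₀ r)) (hg : DifferentiableOn ℂ g (ball x₀ r))
    (v : ℂ → ℂ) (hv : DifferentiableOn ℂ v (ball x₀ r)) (h : ℂ) :
    ∃ w : ℂ → ℂ, DifferentiableOn ℂ w (ball x₀ r) ∧ w x₀ = 0 ∧ ∀ x ∈ ball x₀ r,
      deriv w x = -(totalRemainder b h g v x / transportCoeff b g x) := by
  have h1 : DifferentiableOn ℂ (fun x => -(totalRemainder b h g v x / transportCoeff b g x))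
      (ball x₀ r) := by
    refine DifferentiableOn.neg (DifferentiableOn.div ?_ ?_ hc)
    · exact DifferentiableOn.fun_sum fun j _ =>
        (hb j).mul (differentiableOn_wkbRemainder isOpen_ball hg hv j)
    · exact DifferentiableOn.fun_sum fun j _ => (hb j).mul ((hg.pow _).const_mul _)
  obtain ⟨w, hw0, hw⟩ := h1.isExactOn_ball.with_val_at x₀ 0
  exact ⟨w, fun x hx => (hw x hx).differentiableAt.differentiableWithinAt, hw0,
    fun x hx => (hw x hx).deriv⟩

/-- If the remainder of `v k` is at most `B q`, with `B` the total constant, then `v (k + 1)` is at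
most `B q r / c₀` and its derivative at most `B q / c₀`. The next remainder is then at most `B q (B
r + B θ) / c₀ ≤ B q / 4`, on a disc smaller by `(n + 1) * η`. -/
theorem exists_wkb_sequence (hM : 0 ≤ M) (hR : 0 < R) (hrR : r ≤ R) (hc₀ : 0 < c₀)
    (hη : 0 < η) (hh : 0 ≤ h) (hθ : θ ≤ 1) (hhη : h ≤ θ * η)
    (hr8 : totalConst n M R * r ≤ c₀ / 8) (hθ8 : totalConst n M R * θ ≤ c₀ / 8)
    (hb : ∀ j, DifferentiableOn ℂ (b j) (ball x₀ (2 * R)))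
    (hbM : ∀ j, ∀ x ∈ ball x₀ (2 * R), ‖b j x‖ ≤ M)
    (hg : DifferentiableOn ℂ g (ball x₀ (2 * R))) (hgM : ∀ x ∈ ball x₀ (2 * R), ‖g x‖ ≤ M)
    (hc : ∀ x ∈ ball x₀ (2 * R), c₀ ≤ ‖transportCoeff b g x‖) :
    ∃ v : ℕ → ℂ → ℂ, v 0 = 1 ∧ (∀ k, DifferentiableOn ℂ (v k) (ball x₀ r)) ∧
      (∀ k, ∀ x ∈ ball x₀ r, transportCoeff b g x * deriv (v (k + 1)) x
        = -totalRemainder b h g (v k) x) ∧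
      (∀ k : ℕ, ∀ x ∈ ball x₀ (r - (k + 1) * ((n + 1) * η)),
        ‖totalRemainder b h g (v k) x‖ ≤ totalConst n M R * (1 / 4) ^ k ∧
        ‖v (k + 1) x‖ ≤ 1 / 8 * (1 / 4) ^ k) := by
  have hsub : ball x₀ r ⊆ ball x₀ (2 * R) := ball_subset_ball (by linarith)
  have hc' : ∀ x ∈ ball x₀ r, transportCoeff b g x ≠ 0 := fun x hx h0 => by
    have := hc x (hsub hx)
    rw [h0, norm_zero] at this
    linarith
  have hB : 0 ≤ totalConst n M R := totalConst_nonneg hM hR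
  have hδ : 0 < (n + 1 : ℝ) * η := by positivity
  choose! w hwd hw0 hw using fun v hv =>
    exists_transport_solution hc' (fun j => (hb j).mono hsub) (hg.mono hsub) v hv (h : ℂ)
  have hd : ∀ k, DifferentiableOn ℂ (w^[k] 1) (ball x₀ r) := by
    intro k
    induction k with
    | zero => exact differentiableOn_const 1
    | succ k ih => rw [Function.iterate_succ_apply']; exact hwd _ ih
  have hb1 : ∀ (k : ℕ) (ρ : ℝ), ρ ≤ r → (∀ x ∈ ball x₀ ρ,
      ‖totalRemainder b h g (w^[k] 1) x‖ ≤ totalConst n M R * (1 / 4) ^ k) →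
      ∀ x ∈ ball x₀ ρ, ‖deriv (w^[k + 1] 1) x‖ ≤ totalConst n M R * (1 / 4) ^ k / c₀ := by
    intro k ρ hρ hk x hx
    have hxr := ball_subset_ball hρ hx
    rw [Function.iterate_succ_apply', hw _ (hd k) x hxr, norm_neg, norm_div]
    exact div_le_div₀ (by positivity) (hk x hx) hc₀ (hc x (hsub hxr))
  have hb2 : ∀ (k : ℕ) (ρ : ℝ), ρ ≤ r → (∀ x ∈ ball x₀ ρ,
      ‖totalRemainder b h g (w^[k] 1) x‖ ≤ totalConst n M R * (1 / 4) ^ k) →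
      ∀ x ∈ ball x₀ ρ, ‖w^[k + 1] 1 x‖ ≤ totalConst n M R * (1 / 4) ^ k / c₀ * r := by
    intro k ρ hρ hk x hx
    have hρ0 : 0 < ρ := pos_of_mem_ball hx
    have h1 := (convex_ball x₀ ρ).norm_image_sub_le_of_norm_deriv_le
      (fun y hy => (hd (k + 1)).differentiableAt
        (isOpen_ball.mem_nhds (ball_subset_ball hρ hy))) (hb1 k ρ hρ hk)
      (mem_ball_self hρ0) hx
    have h0 : w^[k + 1] 1 x₀ = 0 := by rw [Function.iterate_succ_apply', hw0 _ (hd k)]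
    rw [h0, sub_zero] at h1
    refine h1.trans ?_
    have : ‖x - x₀‖ ≤ r := by rw [← dist_eq_norm]; exact (mem_ball.1 hx).le.trans hρ
    gcongr
  have hb3 : ∀ k : ℕ, ∀ x ∈ ball x₀ (r - (k + 1) * ((n + 1) * η)),
      ‖totalRemainder b h g (w^[k] 1) x‖ ≤ totalConst n M R * (1 / 4) ^ k := by
    intro k
    induction k with
    | zero =>
      intro x hx
      -- The initial amplitude is the constant 1, so `m₀ = 1` and `m₁ = 0`.
      have := norm_totalRemainder_le (θ := θ) (m₀ := 1) (m₁ := 0) hM hR hrR hη hh hθ hhη hbM hg hgM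
        (hd 0) (by simp) (by simp) zero_le_one le_rfl x (by convert hx using 2; simp)
      simpa using this
    | succ k ih =>
      intro x hx
      have hρ : r - (k + 1) * ((n + 1) * η) ≤ r := by
        have : 0 ≤ (k + 1 : ℝ) * ((n + 1) * η) := by positivity
        linarith
      have := norm_totalRemainder_le hM hR (hρ.trans hrR) hη hh hθ hhη hbM hg hgM
        ((hd (k + 1)).mono (ball_subset_ball hρ)) (hb2 k _ hρ ih) (hb1 k _ hρ ih)
        (mul_nonneg (by positivity) (pos_of_mem_ball (ball_subset_ball (by
          push_cast at hx ⊢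
          have : 0 ≤ (k + 1 + 1 : ℝ) * ((n + 1) * η) := by positivity
          linarith) hx : x ∈ ball x₀ r)).le) (by positivity) x
        (by convert hx using 2; push_cast; ring)
      refine this.trans ?_
      rw [pow_succ]
      have h4 : totalConst n M R * r + totalConst n M R * θ ≤ c₀ * (1 / 4) := by linarith
      have h5 : (totalConst n M R * r + totalConst n M R * θ) / c₀ ≤ 1 / 4 := by
        rw [div_le_iff₀ hc₀]; linarith
      calc _ = totalConst n M R * (1 / 4) ^ k
            * ((totalConst n M R * r + totalConst n M R * θ) / c₀) := by field_simp
        _ ≤ totalConst n M R * (1 / 4) ^ k * (1 / 4) := by gcongr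
        _ = _ := by ring
  refine ⟨fun k => w^[k] 1, rfl, hd, fun k x hx => ?_, fun k x hx => ⟨hb3 k x hx, ?_⟩⟩
  · dsimp only
    rw [Function.iterate_succ_apply', hw _ (hd k) x hx, mul_neg, mul_div_cancel₀ _ (hc' x hx)]
  · refine (hb2 k _ ?_ (hb3 k) x hx).trans ?_
    · have : 0 ≤ (k + 1 : ℝ) * ((n + 1) * η) := by positivity
      linarith
    · have h5 : totalConst n M R * r / c₀ ≤ 1 / 8 := by
        rw [div_le_iff₀ hc₀]; linarith
      calc _ = totalConst n M R * r / c₀ * (1 / 4) ^ k := by ring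
        _ ≤ _ := by gcongr

/-- The sum telescopes: the transport term of `v (k + 1)` cancels the remainder of `v k`, and `v 0 =
1` has no transport term. -/
theorem sum_conjDeriv_sub_eq {v : ℕ → ℂ → ℂ} {s : Set ℂ} {h : ℂ} (hs : IsOpen s)
    (hg : DifferentiableOn ℂ g s) (hv0 : v 0 = 1) (hv : ∀ k, DifferentiableOn ℂ (v k) s)
    (hvt : ∀ k, ∀ x ∈ s, transportCoeff b g x * deriv (v (k + 1)) x
        = -totalRemainder b h g (v k) x) (N : ℕ) :
    ∀ x ∈ s, ∑ j : Fin (n + 1), b j x *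
      ((conjDeriv h g)^[(j : ℕ)] (fun y => ∑ k ∈ Finset.range (N + 1), v k y) x
        - g x ^ (j : ℕ) * ∑ k ∈ Finset.range (N + 1), v k x) = h * totalRemainder b h g (v N) x := by
  intro x hx
  have h1 : ∀ k, ∑ j : Fin (n + 1), b j x *
      ((conjDeriv h g)^[(j : ℕ)] (v k) x - g x ^ (j : ℕ) * v k x)
      = h * (transportCoeff b g x * deriv (v k) x + totalRemainder b h g (v k) x) := by
    intro k
    rw [transportCoeff, totalRemainder, Finset.sum_mul, ← Finset.sum_add_distrib, Finset.mul_sum]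
    refine Finset.sum_congr rfl fun j _ => ?_
    rw [conjDeriv_iterate_eq hs hg (hv k) j x hx]
    ring
  have h2 : ∀ N : ℕ, ∑ k ∈ Finset.range (N + 1),
      (transportCoeff b g x * deriv (v k) x + totalRemainder b h g (v k) x)
      = totalRemainder b h g (v N) x := by
    intro N
    induction N with
    | zero =>
      have : deriv (v 0) x = 0 := by
        rw [hv0]; exact deriv_const x (1 : ℂ)
      simp [this]
    | succ N ih => rw [Finset.sum_range_succ, ih, hvt N x hx]; ring
  rw [← h2 N, Finset.mul_sum, ← Finset.sum_congr rfl fun k _ => h1 k, Finset.sum_comm]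
  refine Finset.sum_congr rfl fun j _ => ?_
  rw [conjDeriv_iterate_sum hs hg hv _ _ x hx, Finset.mul_sum, ← Finset.sum_sub_distrib,
    Finset.mul_sum]

/-- Approximate solutions of the conjugated equation, with exponentially small error. -/
theorem exists_wkb_amplitude (n : ℕ) (hM : 0 ≤ M) (hR : 0 < R) (hc₀ : 0 < c₀) :
    ∃ r₀, 0 < r₀ ∧ r₀ ≤ R ∧ ∀ r, 0 < r → r ≤ r₀ → ∃ γ C h₀ : ℝ, 0 < γ ∧ 0 < C ∧ 0 < h₀ ∧
      ∀ (x₀ : ℂ) (b : Fin (n + 1) → ℂ → ℂ) (g : ℂ → ℂ),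
        (∀ j, DifferentiableOn ℂ (b j) (ball x₀ (2 * R))) →
        (∀ j, ∀ x ∈ ball x₀ (2 * R), ‖b j x‖ ≤ M) →
        DifferentiableOn ℂ g (ball x₀ (2 * R)) → (∀ x ∈ ball x₀ (2 * R), ‖g x‖ ≤ M) →
        (∀ x ∈ ball x₀ (2 * R), c₀ ≤ ‖transportCoeff b g x‖) →
        ∀ h : ℝ, 0 < h → h ≤ h₀ → ∃ u : ℂ → ℂ, DifferentiableOn ℂ u (ball x₀ r) ∧
          (∀ x ∈ ball x₀ (r / 2), ‖u x - 1‖ ≤ 1 / 2) ∧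
          ∀ x ∈ ball x₀ (r / 2), ‖∑ j : Fin (n + 1), b j x *
            ((conjDeriv h g)^[(j : ℕ)] u x - g x ^ (j : ℕ) * u x)‖ ≤ C * Real.exp (-(γ / h)) := by
  set B := totalConst n M R with hBdef
  have hB : 0 ≤ B := totalConst_nonneg hM hR
  -- The `+ 1` covers the case `B = 0`.
  set t := c₀ / (8 * (B + 1)) with ht
  have ht0 : 0 < t := by positivity
  have htB : B * t ≤ c₀ / 8 := by
    rw [ht, mul_div_assoc', div_le_div_iff₀ (by positivity) (by norm_num)]
    nlinarith
  refine ⟨min R t, lt_min hR ht0, min_le_left _ _, fun r hr hrr => ?_⟩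
  obtain ⟨hrR, hrt⟩ := le_min_iff.1 hrr
  set θ := min 1 t with hθdef
  have hθ0 : 0 < θ := lt_min one_pos ht0
  -- With this `γ` one iteration costs radius `(r / 4) * (h / γ)`. For `h ≤ γ`, the `N + 1 ≤ γ / h +
  -- 1` iterations together cost at most `r / 2`.
  set γ := r * θ / (4 * (n + 1)) with hγ
  have hγ0 : 0 < γ := by positivity
  refine ⟨γ, B * Real.exp 1 + 1, min 1 γ, hγ0, by positivity, lt_min one_pos hγ0, ?_⟩
  intro x₀ b g hb hbM hg hgM hc h hh hhh
  obtain ⟨hh1, hhγ⟩ := le_min_iff.1 hhh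
  set η := h / θ with hη
  have hη0 : 0 < η := by positivity
  obtain ⟨v, hv0, hvd, hvt, hvb⟩ := exists_wkb_sequence (θ := θ) (η := η) hM hR hrR hc₀ hη0 hh.le
    (min_le_left _ _) (by rw [hη]; field_simp; rfl)
    ((mul_le_mul_of_nonneg_left hrt hB).trans htB)
    ((mul_le_mul_of_nonneg_left (min_le_right _ _) hB).trans htB) hb hbM hg hgM hc
  have hδ : (n + 1 : ℝ) * η = r / 4 * (h / γ) := by
    rw [hη, hγ]; field_simp
  set N := ⌊γ / h⌋₊ with hN
  have hNle : (N : ℝ) ≤ γ / h := Nat.floor_le (by positivity)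
  have hNlt : γ / h < N + 1 := Nat.lt_floor_add_one _
  have hball : ∀ k : ℕ, k ≤ N → r / 2 ≤ r - (k + 1) * ((n + 1) * η) := by
    intro k hk
    have hk' : (k : ℝ) ≤ γ / h := le_trans (by exact_mod_cast hk) hNle
    have h1 : (k : ℝ) * (h / γ) ≤ 1 := by
      calc (k : ℝ) * (h / γ) ≤ γ / h * (h / γ) := by gcongr
        _ = 1 := by field_simp
    have h2 : h / γ ≤ 1 := (div_le_one hγ0).2 hhγ
    rw [hδ]
    nlinarith
  have hsub : ball x₀ r ⊆ ball x₀ (2 * R) := ball_subset_ball (by linarith)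
  refine ⟨fun y => ∑ k ∈ Finset.range (N + 1), v k y,
    DifferentiableOn.fun_sum fun k _ => hvd k, fun x hx => ?_, fun x hx => ?_⟩
  · have hsum : ∑ k ∈ Finset.range N, (1 / 8 : ℝ) * (1 / 4) ^ k ≤ 1 / 2 := by
      rw [← Finset.mul_sum, geom_sum_eq (by norm_num)]
      have : (0 : ℝ) ≤ (1 / 4) ^ N := by positivity
      norm_num
      linarith
    dsimp only
    rw [Finset.sum_range_succ', hv0, Pi.one_apply, add_sub_cancel_right]
    refine (norm_sum_le_of_le _ fun k hk => ?_).trans hsum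
    exact (hvb k x (ball_subset_ball (hball k (Finset.mem_range.1 hk).le) hx)).2
  · rw [sum_conjDeriv_sub_eq isOpen_ball (hg.mono hsub) hv0 hvd hvt N x
      (ball_subset_ball (by linarith) hx), norm_mul, Complex.norm_real, Real.norm_of_nonneg hh.le]
    have h1 := (hvb N x (ball_subset_ball (hball N le_rfl) hx)).1
    -- Uses `1 / 4 ≤ exp (-1)`; the factor `exp 1` pays for rounding `γ / h` down to `N`.
    have h2 : (1 / 4 : ℝ) ^ N ≤ Real.exp 1 * Real.exp (-(γ / h)) := by
      have h3 : (1 / 4 : ℝ) ≤ Real.exp (-1) := by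
        rw [Real.exp_neg, one_div]
        exact inv_anti₀ (Real.exp_pos 1) (by linarith [Real.exp_one_lt_three])
      calc (1 / 4 : ℝ) ^ N ≤ Real.exp (-1) ^ N := by gcongr
        _ = Real.exp (N * -1) := (Real.exp_nat_mul _ _).symm
        _ ≤ Real.exp (1 + -(γ / h)) := Real.exp_le_exp.2 (by linarith)
        _ = _ := Real.exp_add _ _
    calc h * ‖totalRemainder b h g (v N) x‖ ≤ 1 * (B * (1 / 4) ^ N) := by gcongr
      _ ≤ 1 * (B * (Real.exp 1 * Real.exp (-(γ / h)))) := by gcongr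
      _ ≤ (B * Real.exp 1 + 1) * Real.exp (-(γ / h)) := by
        have := Real.exp_pos (-(γ / h))
        nlinarith

end Amplitude

/-! ### Holomorphic coefficients and roots of the symbol -/

/-- The real Taylor coefficients define a complex power series; their norms are unchanged, so its
radius is still positive. -/
theorem AnalyticAt.exists_complex_extension {f : ℝ → ℂ} {x₀ : ℝ} (hf : AnalyticAt ℝ f x₀) :
    ∃ F : ℂ → ℂ, AnalyticAt ℂ F x₀ ∧ ∀ᶠ x : ℝ in 𝓝 x₀, F x = f x := by
  obtain ⟨p, hp⟩ := hf
  set q : FormalMultilinearSeries ℂ ℂ ℂ :=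
    fun k => ContinuousMultilinearMap.mkPiRing ℂ (Fin k) (p.coeff k) with hq
  have hqc : ∀ k, q.coeff k = p.coeff k := fun k =>
    (ContinuousMultilinearMap.mkPiRing_apply (z := p.coeff k) 1).trans (by simp)
  have hqr : 0 < q.radius := by
    obtain ⟨r, hr0, hr⟩ := ENNReal.lt_iff_exists_nnreal_btwn.1 hp.radius_pos
    obtain ⟨C, -, hC⟩ := p.norm_mul_pow_le_of_lt_radius hr
    refine hr0.trans_le (q.le_radius_of_bound C fun k => ?_)
    rw [FormalMultilinearSeries.norm_apply_eq_norm_coef, hqc,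
      ← FormalMultilinearSeries.norm_apply_eq_norm_coef]
    exact hC k
  have hqs := q.hasFPowerSeriesOnBall hqr
  have hqa : AnalyticAt ℂ (fun z => q.sum (z - x₀)) x₀ := by
    have h0 : AnalyticAt ℂ q.sum ((x₀ : ℂ) - x₀) := by
      rw [sub_self]; exact hqs.analyticAt
    exact h0.comp (f := fun z : ℂ => z - x₀) (analyticAt_id.sub analyticAt_const)
  refine ⟨fun z => q.sum (z - x₀), hqa, ?_⟩
  have h1 := (hasFPowerSeriesAt_iff'.1 hp)
  have h2 := (hasFPowerSeriesAt_iff'.1 hqs.hasFPowerSeriesAt)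
  have h3 : Tendsto (fun x : ℝ => (x : ℂ) - x₀) (𝓝 x₀) (𝓝 0) := by
    have : Continuous fun x : ℝ => (x : ℂ) - x₀ := by fun_prop
    simpa using this.tendsto x₀
  filter_upwards [h1, h3.eventually h2] with x hx1 hx2
  refine hx2.unique ?_
  convert hx1 using 2 with k
  rw [hqc, sub_zero, Complex.real_smul]
  push_cast
  rfl

/-- This is the implicit function theorem at a simple root, jointly in the point and the spectral
parameter; the joint dependence later gives uniformity in `z`. -/
theorem exists_holomorphic_root {n : ℕ} {b : Fin (n + 1) → ℂ → ℂ} {x₀ ζ₀ : ℂ}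
    (hb : ∀ j, AnalyticAt ℂ (b j) x₀)
    (hc : ∑ j, b j x₀ * ((j : ℕ) * ζ₀ ^ ((j : ℕ) - 1)) ≠ 0) :
    ∃ G : ℂ × ℂ → ℂ, AnalyticAt ℂ G (x₀, ∑ j, b j x₀ * ζ₀ ^ (j : ℕ)) ∧
      G (x₀, ∑ j, b j x₀ * ζ₀ ^ (j : ℕ)) = ζ₀ ∧
      ∀ᶠ q in 𝓝 (x₀, ∑ j, b j x₀ * ζ₀ ^ (j : ℕ)), ∑ j, b j q.1 * G q ^ (j : ℕ) = q.2 := by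
  set z₀ := ∑ j, b j x₀ * ζ₀ ^ (j : ℕ) with hz₀
  set F : (ℂ × ℂ) × ℂ → ℂ := fun q => ∑ j, b j q.1.1 * q.2 ^ (j : ℕ) - q.1.2 with hF
  set u : (ℂ × ℂ) × ℂ := ((x₀, z₀), ζ₀) with hu
  have hFa : AnalyticAt ℂ F u := by
    refine AnalyticAt.sub (Finset.analyticAt_fun_sum _ fun j _ => AnalyticAt.mul ?_ ?_) ?_
    · exact AnalyticAt.fun_comp (g := b j) (hb j) (analyticAt_fst.comp analyticAt_fst)
    · exact analyticAt_snd.pow _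
    · exact analyticAt_snd.comp analyticAt_fst
  have hFc : ContDiffAt ℂ ⊤ F u := hFa.contDiffAt
  have hFu : F u = 0 := by simp [hF, hu, hz₀]
  have hinv : (fderiv ℂ F u ∘L .inr ℂ (ℂ × ℂ) ℂ).IsInvertible := by
    have h1 : HasDerivAt (fun ζ => F ((x₀, z₀), ζ))
        ((fderiv ℂ F u ∘L .inr ℂ (ℂ × ℂ) ℂ) 1) ζ₀ := by
      have := (hFa.differentiableAt.hasFDerivAt.comp_hasDerivAt ζ₀
        ((hasDerivAt_const ζ₀ (x₀, z₀)).prodMk (hasDerivAt_id ζ₀)))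
      exact this
    have h2 : HasDerivAt (fun ζ => F ((x₀, z₀), ζ))
        (∑ j : Fin (n + 1), b j x₀ * ((j : ℕ) * ζ₀ ^ ((j : ℕ) - 1))) ζ₀ := by
      refine HasDerivAt.sub_const _ (HasDerivAt.fun_sum fun j _ => ?_)
      exact (hasDerivAt_pow (j : ℕ) ζ₀).const_mul (b j x₀)
    refine ⟨ContinuousLinearEquiv.unitsEquivAut ℂ (Units.mk0 _ hc), ?_⟩
    ext
    rw [h1.unique h2]
    simp
  refine ⟨hFc.implicitFunction (by simp) hinv, ?_, hFc.implicitFunction_apply_self (by simp) hinv,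
    ?_⟩
  · exact (hFc.contDiffAt_implicitFunction (by simp) hinv).analyticAt
  · filter_upwards [hFc.eventually_apply_implicitFunction (by simp) hinv] with q hq
    rw [hFu] at hq
    exact sub_eq_zero.1 hq

/-! ### The bracket condition and the family of phases -/

section Symbol

variable {n : ℕ} {a : Fin (n + 1) → ℝ → ℂ} {b : Fin (n + 1) → ℂ → ℂ} {x₀ ξ₀ : ℝ}

/-- With `∂_ξ f = i c` and `∂_x f = d`, the bracket is `i (c d̄ + c̄ d) = 2 i Re (c d̄)`. -/
theorem halfBracket_semiclassicalSymbol (hb : ∀ j, AnalyticAt ℂ (b j) x₀)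
    (hab : ∀ j, ∀ᶠ x : ℝ in 𝓝 x₀, b j x = a j x) :
    halfBracket (semiclassicalSymbol a) x₀ ξ₀
      = ((∑ j, b j x₀ * ((j : ℕ) * (Complex.I * ξ₀) ^ ((j : ℕ) - 1)))
        * starRingEnd ℂ (∑ j, deriv (b j) x₀ * (Complex.I * ξ₀) ^ (j : ℕ))).re := by
  set c := ∑ j, b j x₀ * ((j : ℕ) * (Complex.I * ξ₀) ^ ((j : ℕ) - 1))
  set d := ∑ j, deriv (b j) x₀ * (Complex.I * ξ₀) ^ (j : ℕ)
  have h1 : HasDerivAt (fun η => semiclassicalSymbol a x₀ η) (c * Complex.I) ξ₀ := by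
    have h : HasDerivAt (fun η : ℂ => ∑ j, b j x₀ * (Complex.I * η) ^ (j : ℕ))
        (c * Complex.I) ξ₀ := by
      rw [Finset.sum_mul]
      refine HasDerivAt.fun_sum fun j _ => ?_
      refine (((hasDerivAt_id _).const_mul Complex.I).fun_pow _ |>.const_mul _).congr_deriv ?_
      simp only [id, mul_one]
      ring
    refine h.comp_ofReal.congr_of_eventuallyEq (Eventually.of_forall fun η => ?_)
    exact Finset.sum_congr rfl fun j _ => by rw [(hab j).self_of_nhds]
  have h2 : HasDerivAt (fun y => semiclassicalSymbol a y ξ₀) d x₀ := by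
    refine HasDerivAt.fun_sum fun j _ => HasDerivAt.mul_const ?_ _
    refine (hb j).differentiableAt.hasDerivAt.comp_ofReal.congr_of_eventuallyEq ?_
    filter_upwards [hab j] with x hx using hx.symm
  have h1' : HasDerivAt (fun η => starRingEnd ℂ (semiclassicalSymbol a x₀ η))
      (starRingEnd ℂ (c * Complex.I)) ξ₀ := h1.star
  have h2' : HasDerivAt (fun y => starRingEnd ℂ (semiclassicalSymbol a y ξ₀))
      (starRingEnd ℂ d) x₀ := h2.star
  rw [halfBracket, poissonBracket, h1.deriv, h2.deriv, h1'.deriv, h2'.deriv]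
  simp
  ring

/-- A holomorphic family of phase derivatives `G z`, with the bounds uniform in `z`, near a point
where the bracket of the symbol is positive. -/
theorem exists_phase_family (ha : ∀ j, AnalyticAt ℝ (a j) x₀)
    (hbr : 0 < halfBracket (semiclassicalSymbol a) x₀ ξ₀) :
    ∃ (b : Fin (n + 1) → ℂ → ℂ) (G : ℂ → ℂ → ℂ) (R M c₀ L : ℝ), 0 < R ∧ 0 ≤ M ∧ 0 < c₀ ∧ 0 ≤ L ∧
      (∀ j, DifferentiableOn ℂ (b j) (ball (x₀ : ℂ) (2 * R))) ∧
      (∀ j, ∀ x ∈ ball (x₀ : ℂ) (2 * R), ‖b j x‖ ≤ M) ∧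
      (∀ j, ∀ x : ℝ, (x : ℂ) ∈ ball (x₀ : ℂ) (2 * R) → b j x = a j x) ∧
      (deriv (G (semiclassicalSymbol a x₀ ξ₀)) x₀).re < 0 ∧
      (G (semiclassicalSymbol a x₀ ξ₀) x₀).re = 0 ∧
      ∀ z ∈ ball (semiclassicalSymbol a x₀ ξ₀) R,
        DifferentiableOn ℂ (G z) (ball (x₀ : ℂ) (2 * R)) ∧
        ∀ x ∈ ball (x₀ : ℂ) (2 * R), ‖G z x‖ ≤ M ∧ c₀ ≤ ‖transportCoeff b (G z) x‖ ∧
          ∑ j, b j x * G z x ^ (j : ℕ) = z ∧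
          ‖G z x - G (semiclassicalSymbol a x₀ ξ₀) x‖
            ≤ L * ‖z - semiclassicalSymbol a x₀ ξ₀‖ := by
  choose b hb hab using fun j => (ha j).exists_complex_extension
  have hbr' := hbr
  rw [halfBracket_semiclassicalSymbol hb hab] at hbr'
  have hz₀ : semiclassicalSymbol a x₀ ξ₀ = ∑ j, b j x₀ * (Complex.I * ξ₀) ^ (j : ℕ) :=
    Finset.sum_congr rfl fun j _ => by rw [(hab j).self_of_nhds]
  set z₀ := semiclassicalSymbol a x₀ ξ₀
  set c := ∑ j, b j x₀ * ((j : ℕ) * (Complex.I * ξ₀) ^ ((j : ℕ) - 1)) with hcdef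
  set d := ∑ j, deriv (b j) x₀ * (Complex.I * ξ₀) ^ (j : ℕ) with hddef
  have hc : c ≠ 0 := fun h0 => by simp [h0] at hbr'
  obtain ⟨G, hGa, hG0, hGz⟩ := exists_holomorphic_root hb hc
  rw [← hz₀] at hGa hG0 hGz
  have hfst : Tendsto Prod.fst (𝓝 ((x₀ : ℂ), z₀)) (𝓝 (x₀ : ℂ)) := continuousAt_fst
  set M := (∑ j, ‖b j x₀‖) + ‖G (x₀, z₀)‖ + 1 with hM
  have hsum0 : 0 ≤ ∑ j, ‖b j x₀‖ := Finset.sum_nonneg fun _ _ => norm_nonneg _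
  have e1 : ∀ᶠ q in 𝓝 ((x₀ : ℂ), z₀), ∀ j, AnalyticAt ℂ (b j) q.1 ∧ ‖b j q.1‖ ≤ M := by
    refine eventually_all.2 fun j => ?_
    refine (hfst.eventually ((hb j).eventually_analyticAt)).and (hfst.eventually (p := fun x => ‖b j x‖ ≤ M) ?_)
    have hlt : ‖b j x₀‖ < M := by
      have := Finset.single_le_sum (f := fun j => ‖b j x₀‖) (fun _ _ => norm_nonneg _)
        (Finset.mem_univ j)
      have := norm_nonneg (G (x₀, z₀))
      simp only [hM]
      linarith
    exact ((hb j).continuousAt.norm.eventually_lt_const hlt).mono fun _ h => h.le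
  have e2 : ∀ᶠ q in 𝓝 ((x₀ : ℂ), z₀), AnalyticAt ℂ G q ∧ ‖G q‖ ≤ M := by
    refine hGa.eventually_analyticAt.and ?_
    have hlt : ‖G (x₀, z₀)‖ < M := by simp only [hM]; linarith
    exact (hGa.continuousAt.norm.eventually_lt_const hlt).mono fun _ h => h.le
  have e3 : ∀ᶠ q in 𝓝 ((x₀ : ℂ), z₀),
      ‖c‖ / 2 ≤ ‖∑ j, b j q.1 * ((j : ℕ) * G q ^ ((j : ℕ) - 1))‖ := by
    have hcont : ContinuousAt (fun q : ℂ × ℂ => ∑ j, b j q.1 * ((j : ℕ) * G q ^ ((j : ℕ) - 1)))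
        ((x₀ : ℂ), z₀) := by
      refine tendsto_finsetSum _ fun j _ => ?_
      exact ((hb j).continuousAt.tendsto.comp hfst).mul
        ((hGa.continuousAt.pow _).const_mul _)
    refine (hcont.norm.eventually_const_lt (u := ‖c‖ / 2) ?_).mono fun _ h => h.le
    dsimp only
    rw [hG0, ← hcdef]
    exact half_lt_self (norm_pos_iff.2 hc)
  obtain ⟨K, t, ht, hK⟩ := (hGa.contDiffAt (n := 1)).exists_lipschitzOnWith
  obtain ⟨ε, hε, hball⟩ := Metric.eventually_nhds_iff_ball.1
    (((e1.and e2).and (e3.and hGz)).and (eventually_mem_set.2 ht))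
  have e4 : ∀ᶠ x : ℝ in 𝓝 x₀, ∀ j, b j x = a j x := eventually_all.2 hab
  obtain ⟨ε', hε', hball'⟩ := Metric.eventually_nhds_iff_ball.1 e4
  set R := min ε ε' / 2 with hR
  have hR0 : 0 < R := by positivity
  have hRε : 2 * R ≤ ε := by rw [hR]; linarith [min_le_left ε ε']
  have hRε' : 2 * R ≤ ε' := by rw [hR]; linarith [min_le_right ε ε']
  have hmem : ∀ z ∈ ball z₀ R, ∀ x ∈ ball (x₀ : ℂ) (2 * R), (x, z) ∈ ball ((x₀ : ℂ), z₀) ε := by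
    intro z hz x hx
    rw [← ball_prod_same]
    exact ⟨ball_subset_ball hRε hx, ball_subset_ball (by linarith) hz⟩
  have hz0 : z₀ ∈ ball z₀ R := mem_ball_self hR0
  have hGd : ∀ z ∈ ball z₀ R, ∀ x ∈ ball (x₀ : ℂ) (2 * R),
      DifferentiableAt ℂ (fun y => G (y, z)) x := fun z hz x hx =>
    (hball _ (hmem z hz x hx)).1.1.2.1.differentiableAt.comp x
      (differentiableAt_id.prodMk (differentiableAt_const z))
  have hx0 : (x₀ : ℂ) ∈ ball (x₀ : ℂ) (2 * R) := mem_ball_self (by positivity)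
  refine ⟨b, fun z x => G (x, z), R, M, ‖c‖ / 2, K, hR0, by positivity,
    by have := norm_pos_iff.2 hc; positivity, K.2, ?_, ?_, ?_, ?_, ?_, ?_⟩
  · exact fun j x hx =>
      ((hball _ (hmem z₀ hz0 x hx)).1.1.1 j).1.differentiableAt.differentiableWithinAt
  · exact fun j x hx => ((hball _ (hmem z₀ hz0 x hx)).1.1.1 j).2
  · intro j x hx
    refine hball' x ?_ j
    rw [mem_ball, Complex.isometry_ofReal.dist_eq] at hx
    exact hx.trans_le hRε'
  -- Differentiating the eikonal equation in `x` gives `d + c G' = 0`, so `Re (c d̄) = -|c|² Re G'`,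
  -- and the positive bracket forces `Re G' < 0`.
  · set G' := deriv (fun x => G (x, z₀)) x₀
    have h1 : HasDerivAt (fun x => ∑ j, b j x * G (x, z₀) ^ (j : ℕ)) (d + c * G') x₀ := by
      rw [hcdef, hddef, Finset.sum_mul, ← Finset.sum_add_distrib]
      refine HasDerivAt.fun_sum fun j _ => ?_
      refine ((hb j).differentiableAt.hasDerivAt.fun_mul
        ((hGd z₀ hz0 x₀ hx0).hasDerivAt.fun_pow (j : ℕ))).congr_deriv ?_
      rw [hG0]
      ring
    have h2 : HasDerivAt (fun x => ∑ j, b j x * G (x, z₀) ^ (j : ℕ)) 0 x₀ := by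
      refine (hasDerivAt_const (x₀ : ℂ) z₀).congr_of_eventuallyEq ?_
      filter_upwards [isOpen_ball.mem_nhds hx0] with x hx
      exact (hball _ (hmem z₀ hz0 x hx)).1.2.2
    have h3 : d = -(c * G') := eq_neg_of_add_eq_zero_left (h1.unique h2)
    have h4 : (c * starRingEnd ℂ d).re = -(Complex.normSq c * G'.re) := by
      rw [h3, map_neg, map_mul, Complex.normSq_apply]
      simp
      ring
    rw [h4] at hbr'
    have := Complex.normSq_pos.2 hc
    by_contra hneg
    push Not at hneg
    nlinarith [mul_nonneg this.le hneg]
  · change (G (x₀, z₀)).re = 0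
    simp [hG0]
  · intro z hz
    refine ⟨fun x hx => (hGd z hz x hx).differentiableWithinAt, fun x hx => ?_⟩
    have hm := hball _ (hmem z hz x hx)
    refine ⟨hm.1.1.2.2, hm.1.2.1, hm.1.2.2, ?_⟩
    refine (hK.norm_sub_le hm.2 (hball _ (hmem z₀ hz0 x hx)).2).trans_eq ?_
    rw [Prod.mk_sub_mk, sub_self, Prod.norm_mk, norm_zero, max_eq_right (norm_nonneg _)]

end Symbol

/-- On the real line the linear Taylor term of `Φ` is imaginary and the quadratic one has real part
`Re g'(x₀) (x - x₀) ^ 2 / 2`. The radius is chosen so that the error spends at most half of this. -/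
theorem exists_re_phase_le {g : ℂ → ℂ} {x₀ : ℝ} (hg : DifferentiableAt ℂ g x₀)
    (hg0 : (g x₀).re = 0) (hg1 : (deriv g x₀).re < 0) :
    ∃ s κ : ℝ, 0 < s ∧ 0 < κ ∧ ∀ (Φ : ℂ → ℂ) (r : ℝ), r ≤ s →
      (∀ x ∈ ball (x₀ : ℂ) r, HasDerivAt Φ (g x) x) → Φ x₀ = 0 →
      ∀ x : ℝ, |x - x₀| < r → (Φ x).re ≤ -(κ * (x - x₀) ^ 2) := by
  set m := deriv g x₀
  have hκ : 0 < -m.re / 4 := by linarith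
  obtain ⟨s, hs, hball⟩ := Metric.eventually_nhds_iff_ball.1
    (hg.hasDerivAt.hasFDerivAt.isLittleO.bound hκ)
  refine ⟨s, -m.re / 4, hs, hκ, fun Φ r hr hΦ hΦ0 x hx => ?_⟩
  set ρ := |x - x₀|
  have hsub : closedBall (x₀ : ℂ) ρ ⊆ ball (x₀ : ℂ) r := closedBall_subset_ball hx
  have hxρ : ‖(x : ℂ) - x₀‖ = ρ := by
    rw [← Complex.ofReal_sub, Complex.norm_real, Real.norm_eq_abs]
  have h1 : ∀ y ∈ closedBall (x₀ : ℂ) ρ, HasDerivWithinAt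
      (fun y => Φ y - g x₀ * (y - x₀) - m * (y - x₀) ^ 2 / 2)
      (g y - g x₀ - m * (y - x₀)) (closedBall (x₀ : ℂ) ρ) y := by
    intro y hy
    have d0 := (hasDerivAt_id y).sub_const (x₀ : ℂ)
    refine ((((hΦ y (hsub hy)).sub (d0.const_mul (g x₀))).sub
      (((d0.fun_pow 2).const_mul m).div_const 2)).congr_deriv ?_).hasDerivWithinAt
    simp
    ring
  have h2 : ∀ y ∈ closedBall (x₀ : ℂ) ρ, ‖g y - g x₀ - m * (y - x₀)‖ ≤ -m.re / 4 * ρ := by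
    intro y hy
    have h3 := hball y (ball_subset_ball hr (hsub hy))
    rw [mem_closedBall, dist_eq_norm] at hy
    rw [ContinuousLinearMap.toSpanSingleton_apply, smul_eq_mul, mul_comm (y - (x₀ : ℂ))] at h3
    exact h3.trans (by gcongr)
  have h4 := (convex_closedBall (x₀ : ℂ) ρ).norm_image_sub_le_of_norm_hasDerivWithin_le h1 h2
    (mem_closedBall_self (abs_nonneg _)) (y := (x : ℂ)) (by
      rw [mem_closedBall, dist_eq_norm, hxρ])
  rw [hxρ, hΦ0] at h4
  have h5 := (Complex.re_le_norm _).trans h4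
  have h6 : (x - x₀) ^ 2 = ρ * ρ := by rw [← sq_abs]; ring
  have h7 : (m * ((x : ℂ) - x₀) ^ 2 / 2).re = m.re * (x - x₀) ^ 2 / 2 := by
    rw [← Complex.ofReal_sub, ← Complex.ofReal_pow, ← Complex.ofReal_ofNat, Complex.div_ofReal_re,
      Complex.re_mul_ofReal]
  have h8 : (g x₀ * ((x : ℂ) - x₀)).re = 0 := by
    rw [← Complex.ofReal_sub, Complex.re_mul_ofReal, hg0, zero_mul]
  simp only [Complex.sub_re, h7, h8, sub_self, mul_zero, Complex.zero_re] at h5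
  rw [h6] at h5 ⊢
  norm_num at h5
  linarith

/-! ### Restriction to the line, cutoffs and `L²` comparison -/

section RealLine

variable {V : ℂ → ℂ} {U : Set ℂ}

theorem iteratedDeriv_comp_ofReal_of_differentiableOn (hU : IsOpen U)
    (hV : DifferentiableOn ℂ V U) (j : ℕ) :
    ∀ x : ℝ, (x : ℂ) ∈ U → iteratedDeriv j (fun y : ℝ => V y) x = iteratedDeriv j V x := by
  induction j with
  | zero => intro x _; simp
  | succ j ih =>
    intro x hx
    have hev : iteratedDeriv j (fun y : ℝ => V y) =ᶠ[𝓝 x] fun y : ℝ => iteratedDeriv j V y := by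
      filter_upwards [Complex.continuous_ofReal.continuousAt.preimage_mem_nhds (hU.mem_nhds hx)]
        with y hy using ih y hy
    have hd : DifferentiableAt ℂ (iteratedDeriv j V) x := by
      rw [iteratedDeriv_eq_iterate]
      exact ((hV.analyticOnNhd hU).iterated_deriv j x hx).differentiableAt
    rw [iteratedDeriv_succ, iteratedDeriv_succ, hev.deriv_eq, hd.hasDerivAt.comp_ofReal.deriv]

theorem contDiffAt_comp_ofReal (hU : IsOpen U) (hV : DifferentiableOn ℂ V U) {x : ℝ}
    (hx : (x : ℂ) ∈ U) : ContDiffAt ℝ ∞ (fun y : ℝ => V y) x := by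
  have h1 : ContDiffAt ℂ ∞ V x := (hV.analyticOnNhd hU x hx).contDiffAt
  exact h1.restrict_scalars ℝ |>.comp x Complex.ofRealCLM.contDiff.contDiffAt

/-- Leibniz' rule together with Cauchy estimates on complex discs of radius `s`: sup bounds on `V`
alone control all derivatives, with a constant independent of `V` and hence of `h`. -/
theorem exists_norm_iteratedDeriv_cutoff_mul_le {χ : ℝ → ℂ} (hχ : ContDiff ℝ ∞ χ)
    (hχc : HasCompactSupport χ) {s : ℝ} (hs : 0 < s) (n : ℕ) :
    ∃ C : ℝ, 0 ≤ C ∧ ∀ (V : ℂ → ℂ) (U : Set ℂ) (D x : ℝ), IsOpen U → DifferentiableOn ℂ V U →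
      closedBall (x : ℂ) s ⊆ U → (∀ y ∈ closedBall (x : ℂ) s, ‖V y‖ ≤ D) →
      ∀ j ≤ n, ‖iteratedDeriv j (fun y : ℝ => χ y * V y) x‖ ≤ C * D := by
  have hX : ∀ i : ℕ, ∃ X : ℝ, ∀ x, ‖iteratedDeriv i χ x‖ ≤ X := by
    intro i
    have hcont := hχ.continuous_iteratedDeriv i (by exact_mod_cast le_top)
    have hcs : HasCompactSupport (iteratedDeriv i χ) := by
      rw [iteratedDeriv_eq_iterate]
      induction i with
      | zero => exact hχc
      | succ i ih =>
        rw [Function.iterate_succ_apply']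
        exact (ih (hχ.continuous_iteratedDeriv i (by exact_mod_cast le_top))).deriv
    exact hcs.exists_bound_of_continuous hcont
  choose X hX using hX
  have hX0 : ∀ i, 0 ≤ X i := fun i => (norm_nonneg _).trans (hX i 0)
  set T : ℕ → ℝ := fun j => ∑ i ∈ Finset.range (j + 1),
    (j.choose i : ℝ) * X i * ((j - i).factorial / s ^ (j - i)) with hT
  have hT0 : ∀ j, 0 ≤ T j := fun j => Finset.sum_nonneg fun i _ =>
    mul_nonneg (mul_nonneg (by positivity) (hX0 i)) (by positivity)
  refine ⟨∑ j ∈ Finset.range (n + 1), T j, Finset.sum_nonneg fun j _ => hT0 j, ?_⟩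
  intro V U D x hU hV hsub hD j hj
  have hxU : (x : ℂ) ∈ U := hsub (mem_closedBall_self hs.le)
  have hD0 : 0 ≤ D := (norm_nonneg _).trans (hD x (mem_closedBall_self hs.le))
  have hle : T j ≤ ∑ j ∈ Finset.range (n + 1), T j :=
    Finset.single_le_sum (fun j _ => hT0 j) (Finset.mem_range.2 (Nat.lt_succ_of_le hj))
  refine le_trans ?_ (mul_le_mul_of_nonneg_right hle hD0)
  rw [iteratedDeriv_fun_mul ((hχ.of_le (by exact_mod_cast le_top)).contDiffAt)
    ((contDiffAt_comp_ofReal hU hV hxU).of_le (by exact_mod_cast le_top)), hT, Finset.sum_mul]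
  refine norm_sum_le_of_le _ fun i _ => ?_
  rw [iteratedDeriv_comp_ofReal_of_differentiableOn hU hV _ x hxU, norm_mul, norm_mul,
    Complex.norm_natCast, mul_assoc _ _ D]
  have h1 := norm_iteratedDeriv_le_of_closedBall_subset hs hV hsub hD (j - i)
  rw [mul_div_right_comm] at h1
  have h2 := hX i x
  have h3 := hX0 i
  gcongr

-- Both norms are compared with those of constants on intervals, of lengths `2 * ρ` and `2 * h`.
open MeasureTheory in
theorem eLpNorm_two_lt_of_bounds {f₁ f₂ : ℝ → ℂ} {x₀ A m q ρ h : ℝ} (hA : 0 ≤ A)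
    (hm : 0 ≤ m) (hq : 0 ≤ q) (hρ : 0 ≤ ρ)
    (h₁ : ∀ x ∈ closedBall x₀ ρ, ‖f₁ x‖ ≤ A) (h₁' : ∀ x ∉ closedBall x₀ ρ, f₁ x = 0)
    (h₂ : ∀ x ∈ closedBall x₀ h, m ≤ ‖f₂ x‖) (hlt : A ^ 2 * ρ < (q * m) ^ 2 * h) :
    eLpNorm f₁ 2 volume < ENNReal.ofReal q * eLpNorm f₂ 2 volume := by
  have hh : 0 < h := by
    by_contra hc
    have : 0 ≤ A ^ 2 * ρ := by positivity
    have : (q * m) ^ 2 * h ≤ 0 := mul_nonpos_of_nonneg_of_nonpos (by positivity) (not_lt.1 hc)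
    linarith
  have key : ∀ c t : ℝ, 0 ≤ c → 0 ≤ t →
      eLpNorm ((closedBall x₀ t).indicator fun _ => c) 2 volume
        = ENNReal.ofReal (c * √(2 * t)) := by
    intro c t hc ht
    rw [eLpNorm_indicator_const measurableSet_closedBall (by norm_num) (by norm_num),
      Real.volume_closedBall, Real.sqrt_eq_rpow, ENNReal.ofReal_mul hc, Real.enorm_of_nonneg hc,
      ENNReal.ofReal_rpow_of_nonneg (by positivity) (by norm_num)]
    norm_num
  have e1 : eLpNorm f₁ 2 volume ≤ ENNReal.ofReal (A * √(2 * ρ)) := by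
    rw [← key A ρ hA hρ]
    refine eLpNorm_mono_real fun x => ?_
    by_cases hx : x ∈ closedBall x₀ ρ
    · rw [Set.indicator_of_mem hx]; exact h₁ x hx
    · rw [Set.indicator_of_notMem hx, h₁' x hx, norm_zero]
  have e2 : ENNReal.ofReal (m * √(2 * h)) ≤ eLpNorm f₂ 2 volume := by
    rw [← key m h hm hh.le]
    refine eLpNorm_mono fun x => ?_
    by_cases hx : x ∈ closedBall x₀ h
    · rw [Set.indicator_of_mem hx, Real.norm_of_nonneg hm]; exact h₂ x hx
    · rw [Set.indicator_of_notMem hx, norm_zero]; exact norm_nonneg _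
  refine (e1.trans_lt ?_).trans_le (mul_le_mul_right e2 _)
  have hpos : A * √(2 * ρ) < q * (m * √(2 * h)) := by
    refine lt_of_pow_lt_pow_left₀ 2 (by positivity) ?_
    rw [← mul_assoc, mul_pow, mul_pow _ (√(2 * h)), Real.sq_sqrt (by positivity),
      Real.sq_sqrt (by positivity)]
    linarith
  rw [← ENNReal.ofReal_mul hq]
  exact (ENNReal.ofReal_lt_ofReal_iff_of_nonneg (by positivity)).2 hpos

end RealLine

theorem exists_cutoff (x₀ : ℝ) {r : ℝ} (hr : 0 < r) : ∃ χ : ℝ → ℂ, ContDiff ℝ ∞ χ ∧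
    HasCompactSupport χ ∧ tsupport χ ⊆ closedBall x₀ (3 * r / 8) ∧
    ∀ x ∈ ball x₀ (r / 4), χ x = 1 := by
  let f : ContDiffBump x₀ := ⟨r / 4, 3 * r / 8, by positivity, by linarith⟩
  have hts : tsupport (fun x => (f x : ℂ)) ⊆ tsupport f :=
    closure_mono fun x hx => by
      simpa using hx
  refine ⟨fun x => f x, Complex.ofRealCLM.contDiff.comp f.contDiff,
    f.hasCompactSupport.mono (fun x hx => by simpa using hx), hts.trans f.tsupport_eq.le,
    fun x hx => ?_⟩
  dsimp only
  rw [f.one_of_mem_closedBall (ball_subset_closedBall hx), Complex.ofReal_one]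

/-- Giving up half of the exponent absorbs the constants and the interval length `h`, because `exp
(-t) ≤ 2 / t ^ 2`. -/
theorem exp_neg_lt_of_le {A m ρ γ h : ℝ} (hρ : 0 ≤ ρ) (hγ : 0 < γ) (hh : 0 < h)
    (hh₀ : h ≤ m ^ 2 * γ ^ 2 / (4 * (A ^ 2 * ρ + 1))) :
    (A * Real.exp (-(γ / h))) ^ 2 * ρ < (Real.exp (-(γ / (2 * h))) * m) ^ 2 * h := by
  set E := Real.exp (-(γ / h)) with hE
  have hE0 : 0 < E := Real.exp_pos _
  have hE2 : Real.exp (-(γ / (2 * h))) ^ 2 = E := by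
    rw [← Real.exp_nat_mul, hE]; congr 1; push_cast; field_simp
  have hE3 : E * γ ^ 2 ≤ 2 * h ^ 2 := by
    have h1 := Real.quadratic_le_exp_of_nonneg (x := γ / h) (by positivity)
    have h2 : (γ / h) ^ 2 / 2 ≤ Real.exp (γ / h) := by
      have : 0 ≤ γ / h := by positivity
      linarith
    have h3 : E * Real.exp (γ / h) = 1 := by rw [hE, ← Real.exp_add]; simp
    have h4 := mul_le_mul_of_nonneg_left h2 hE0.le
    rw [h3] at h4
    have h5 : E * ((γ / h) ^ 2 / 2) = E * γ ^ 2 / (2 * h ^ 2) := by field_simp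
    rw [h5, div_le_one (by positivity)] at h4
    exact h4
  have hQ : 0 < A ^ 2 * ρ + 1 := by positivity
  rw [le_div_iff₀ (by positivity)] at hh₀
  rw [mul_pow, mul_pow, hE2]
  have h6 : E * (A ^ 2 * ρ) < m ^ 2 * h := by
    have hγ2 : 0 < γ ^ 2 := by positivity
    refine lt_of_mul_lt_mul_right ?_ hγ2.le
    calc E * (A ^ 2 * ρ) * γ ^ 2 = E * γ ^ 2 * (A ^ 2 * ρ) := by ring
      _ ≤ 2 * h ^ 2 * (A ^ 2 * ρ) := by gcongr
      _ < h * (h * (4 * (A ^ 2 * ρ + 1))) := by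
        have : 0 ≤ A ^ 2 * ρ := by positivity
        nlinarith [mul_pos hh hh]
      _ ≤ h * (m ^ 2 * γ ^ 2) := by gcongr
      _ = m ^ 2 * h * γ ^ 2 := by ring
  nlinarith

/-! ### Construction of the pseudomodes -/

section Pseudomode

variable {n : ℕ} {a : Fin (n + 1) → ℝ → ℂ} {b : Fin (n + 1) → ℂ → ℂ} {g Φ u : ℂ → ℂ} {z : ℂ}
  {x₀ r M h : ℝ} {χ : ℝ → ℂ}

theorem isTestFunction_mul_comp_ofReal {V : ℂ → ℂ} {U : Set ℂ} (hU : IsOpen U)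
    (hV : DifferentiableOn ℂ V U) (hχ : ContDiff ℝ ∞ χ) (hχc : HasCompactSupport χ)
    (hχU : ∀ x ∈ tsupport χ, (x : ℂ) ∈ U) : IsTestFunction fun x => χ x * V x := by
  refine ⟨contDiff_iff_contDiffAt.2 fun x => ?_, hχc.mul_right⟩
  by_cases hx : x ∈ tsupport χ
  · exact hχ.contDiffAt.mul (contDiffAt_comp_ofReal hU hV (hχU x hx))
  · refine (contDiffAt_const (c := (0 : ℂ))).congr_of_eventuallyEq ?_
    filter_upwards [notMem_tsupport_iff_eventuallyEq.1 hx] with y hy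
    rw [hy, Pi.zero_apply, zero_mul]

theorem semiclassicalOp_congr {ψ φ : ℝ → ℂ} {x : ℝ} (hψ : ψ =ᶠ[𝓝 x] φ) :
    semiclassicalOp a h ψ x = semiclassicalOp a h φ x :=
  Finset.sum_congr rfl fun j _ => by rw [hψ.iteratedDeriv_eq]

theorem semiclassicalOp_wkb (hh : h ≠ 0) {s : Set ℂ} (hs : IsOpen s)
    (hab : ∀ j, ∀ x : ℝ, (x : ℂ) ∈ s → b j x = a j x) (hg : DifferentiableOn ℂ g s)
    (hΦ : ∀ x ∈ s, HasDerivAt Φ (g x) x) (hu : DifferentiableOn ℂ u s)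
    (hz : ∀ x ∈ s, ∑ j, b j x * g x ^ (j : ℕ) = z) {x : ℝ} (hx : (x : ℂ) ∈ s) :
    semiclassicalOp a h (fun y : ℝ => Complex.exp (Φ y / h) * u y) x
        - z * (Complex.exp (Φ x / h) * u x)
      = Complex.exp (Φ x / h) * ∑ j : Fin (n + 1), b j x *
          ((conjDeriv h g)^[(j : ℕ)] u x - g x ^ (j : ℕ) * u x) := by
  have hV : DifferentiableOn ℂ (fun y => Complex.exp (Φ y / h) * u y) s := fun y hy =>
    (((hΦ y hy).div_const (h : ℂ)).cexp.differentiableAt.differentiableWithinAt).mul (hu y hy)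
  rw [semiclassicalOp, ← hz x hx, Finset.sum_mul, ← Finset.sum_sub_distrib, Finset.mul_sum]
  refine Finset.sum_congr rfl fun j _ => ?_
  rw [iteratedDeriv_comp_ofReal_of_differentiableOn hs hV _ x hx, mul_assoc,
    iteratedDeriv_exp_mul (Complex.ofReal_ne_zero.2 hh) hs hΦ hg hu j x hx, hab j x hx]
  ring

theorem norm_semiclassicalOp_sub_le {ψ : ℝ → ℂ} {x D : ℝ} (hh0 : 0 ≤ h) (hh1 : h ≤ 1)
    (haM : ∀ j, ‖a j x‖ ≤ M) (hψ : ∀ j ≤ n, ‖iteratedDeriv j ψ x‖ ≤ D) :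
    ‖semiclassicalOp a h ψ x - z * ψ x‖ ≤ ((n + 1) * M + ‖z‖) * D := by
  have hD : 0 ≤ D := (norm_nonneg _).trans (hψ 0 (Nat.zero_le _))
  have hM : 0 ≤ M := (norm_nonneg _).trans (haM 0)
  have h1 : ‖semiclassicalOp a h ψ x‖ ≤ (n + 1) * M * D := by
    have : ‖semiclassicalOp a h ψ x‖ ≤ ∑ _j : Fin (n + 1), M * D := by
      refine norm_sum_le_of_le _ fun j _ => ?_
      rw [norm_mul, norm_mul, norm_pow, Complex.norm_real, Real.norm_of_nonneg hh0]
      have h2 := hψ j (Nat.lt_succ_iff.1 j.2)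
      have h3 := haM j
      have h4 : h ^ (j : ℕ) ≤ 1 := pow_le_one₀ hh0 hh1
      calc _ ≤ M * 1 * D := by gcongr
        _ = _ := by ring
    simpa [mul_assoc] using this
  have h2 : ‖z * ψ x‖ ≤ ‖z‖ * D := by
    rw [norm_mul]
    have := hψ 0 (Nat.zero_le _)
    rw [iteratedDeriv_zero] at this
    gcongr
  calc _ ≤ _ := norm_sub_le _ _
    _ ≤ (n + 1) * M * D + ‖z‖ * D := add_le_add h1 h2
    _ = _ := by ring

theorem norm_exp_div_mul_le {A : ℝ} {x : ℂ} (hh : 0 < h) (hA : (Φ x).re ≤ A)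
    (hux : ‖u x - 1‖ ≤ 1 / 2) :
    ‖Complex.exp (Φ x / h) * u x‖ ≤ 3 / 2 * Real.exp (A / h) := by
  have h1 : ‖u x‖ ≤ 3 / 2 := by
    have := norm_add_le (u x - 1) 1
    rw [sub_add_cancel, norm_one] at this
    linarith
  rw [norm_mul, Complex.norm_exp, Complex.div_ofReal_re, mul_comm]
  gcongr

/-- The bounds for a WKB function cut off near the maximum of its modulus. -/
theorem wkb_cutoff_bounds {γ β γ' C C₁ s : ℝ} (hr : 0 < r) (hs : s ≤ r / 16) (hs0 : 0 < s)
    (hh : 0 < h) (hh1 : h ≤ 1) (hhr : h < r / 4)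
    (hab : ∀ j, ∀ x : ℝ, (x : ℂ) ∈ ball (x₀ : ℂ) r → b j x = a j x)
    (hbM : ∀ j, ∀ x ∈ ball (x₀ : ℂ) r, ‖b j x‖ ≤ M)
    (hg : DifferentiableOn ℂ g (ball (x₀ : ℂ) r)) (hgM : ∀ x ∈ ball (x₀ : ℂ) r, ‖g x‖ ≤ M)
    (hz : ∀ x ∈ ball (x₀ : ℂ) r, ∑ j, b j x * g x ^ (j : ℕ) = z)
    (hΦ : ∀ x ∈ ball (x₀ : ℂ) r, HasDerivAt Φ (g x) x) (hΦ0 : Φ x₀ = 0)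
    (hΦ1 : ∀ x : ℝ, |x - x₀| < r / 4 → (Φ x).re ≤ γ / 2)
    (hΦ2 : ∀ x : ℝ, r / 4 ≤ |x - x₀| → |x - x₀| ≤ 3 * r / 8 → ∀ y ∈ closedBall (x : ℂ) s,
      (Φ y).re ≤ -β)
    (hu : DifferentiableOn ℂ u (ball (x₀ : ℂ) r))
    (hu1 : ∀ x ∈ ball (x₀ : ℂ) (r / 2), ‖u x - 1‖ ≤ 1 / 2)
    (hures : ∀ x ∈ ball (x₀ : ℂ) (r / 2), ‖∑ j : Fin (n + 1), b j x *
      ((conjDeriv h g)^[(j : ℕ)] u x - g x ^ (j : ℕ) * u x)‖ ≤ C * Real.exp (-(γ / h)))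
    (hχ : tsupport χ ⊆ closedBall x₀ (3 * r / 8)) (hχ1 : ∀ x ∈ ball x₀ (r / 4), χ x = 1)
    (hC₁ : 0 ≤ C₁) (hC : 0 ≤ C)
    (hχC : ∀ (V : ℂ → ℂ) (U : Set ℂ) (D x : ℝ), IsOpen U → DifferentiableOn ℂ V U →
      closedBall (x : ℂ) s ⊆ U → (∀ y ∈ closedBall (x : ℂ) s, ‖V y‖ ≤ D) →
      ∀ j ≤ n, ‖iteratedDeriv j (fun y : ℝ => χ y * V y) x‖ ≤ C₁ * D)
    (hγ' : γ' ≤ γ / 2) (hβ' : γ' ≤ β) {ψ : ℝ → ℂ}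
    (hψ : ψ = fun x : ℝ => χ x * (Complex.exp (Φ x / h) * u x)) :
    (∀ x ∈ closedBall x₀ (3 * r / 8), ‖semiclassicalOp a h ψ x - z * ψ x‖
      ≤ (C + ((n + 1) * M + ‖z‖) * (C₁ * (3 / 2))) * Real.exp (-(γ' / h))) ∧
    (∀ x ∉ closedBall x₀ (3 * r / 8), semiclassicalOp a h ψ x - z * ψ x = 0) ∧
    ∀ x ∈ closedBall x₀ h, Real.exp (-M) / 2 ≤ ‖ψ x‖ := by
  have hdist : ∀ x : ℝ, dist (x : ℂ) x₀ = |x - x₀| := fun x => by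
    rw [Complex.isometry_ofReal.dist_eq, Real.dist_eq]
  have hV : DifferentiableOn ℂ (fun y => Complex.exp (Φ y / h) * u y) (ball (x₀ : ℂ) r) :=
    fun y hy => (((hΦ y hy).div_const (h : ℂ)).cexp.differentiableAt.differentiableWithinAt).mul
      (hu y hy)
  have hM : 0 ≤ M := (norm_nonneg _).trans (hgM x₀ (mem_ball_self hr))
  have hexp : ∀ t : ℝ, γ' ≤ t → Real.exp (-(t / h)) ≤ Real.exp (-(γ' / h)) := fun t ht =>
    Real.exp_le_exp.2 (neg_le_neg (by gcongr))
  have hD : 0 ≤ ((n + 1) * M + ‖z‖) * (C₁ * (3 / 2)) := by positivity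
  refine ⟨fun x hx => ?_, fun x hx => ?_, fun x hx => ?_⟩
  · rw [mem_closedBall, Real.dist_eq] at hx
    -- Where the cutoff is 1, the WKB residual `exp (-γ / h)` beats a possible growth `exp (γ / (2 *
    -- h))` of the phase factor. In the transition zone the phase factor itself is small.
    rcases lt_or_ge |x - x₀| (r / 4) with hlt | hge
    · have hev : ψ =ᶠ[𝓝 x] fun y : ℝ => Complex.exp (Φ y / h) * u y := by
        have hx4 : x ∈ ball x₀ (r / 4) := by rwa [mem_ball, Real.dist_eq]
        filter_upwards [isOpen_ball.mem_nhds hx4] with y hy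
        rw [hψ]
        simp only [hχ1 y hy, one_mul]
      have hx2 : (x : ℂ) ∈ ball (x₀ : ℂ) (r / 2) := by rw [mem_ball, hdist]; linarith
      rw [semiclassicalOp_congr hev, hev.eq_of_nhds, semiclassicalOp_wkb hh.ne' isOpen_ball hab hg
        hΦ hu hz (ball_subset_ball (by linarith) hx2), norm_mul, Complex.norm_exp,
        Complex.div_ofReal_re]
      calc _ ≤ Real.exp (γ / 2 / h) * (C * Real.exp (-(γ / h))) := by
            have := hures x hx2
            have := hΦ1 x hlt
            gcongr
        _ = C * Real.exp (-(γ / 2 / h)) := by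
            rw [mul_left_comm, ← Real.exp_add]; congr 2; ring
        _ ≤ C * Real.exp (-(γ' / h)) := by have := hexp _ hγ'; gcongr
        _ ≤ _ := by gcongr; linarith
    · have hsub : closedBall (x : ℂ) s ⊆ ball (x₀ : ℂ) (r / 2) :=
        closedBall_subset_ball' (by rw [hdist]; linarith)
      have hb := hχC _ _ (3 / 2 * Real.exp (-β / h)) x isOpen_ball hV
        (hsub.trans (ball_subset_ball (by linarith))) fun y hy =>
          norm_exp_div_mul_le hh (hΦ2 x hge hx y hy) (hu1 y (hsub hy))
      have hxr : (x : ℂ) ∈ ball (x₀ : ℂ) r := by rw [mem_ball, hdist]; linarith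
      rw [← hψ] at hb
      refine (norm_semiclassicalOp_sub_le hh.le hh1
        (fun j => by rw [← hab j x hxr]; exact hbM j x hxr) hb).trans ?_
      have := hexp _ hβ'
      calc _ = ((n + 1) * M + ‖z‖) * (C₁ * (3 / 2)) * Real.exp (-(β / h)) := by
            rw [neg_div]; ring
        _ ≤ ((n + 1) * M + ‖z‖) * (C₁ * (3 / 2)) * Real.exp (-(γ' / h)) := by gcongr
        _ ≤ _ := by gcongr; linarith
  · have hx' : x ∉ tsupport χ := fun hx' => hx (hχ hx')
    have hev : ψ =ᶠ[𝓝 x] fun _ => 0 := by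
      filter_upwards [notMem_tsupport_iff_eventuallyEq.1 hx'] with y hy
      rw [hψ]
      simp only [hy, Pi.zero_apply, zero_mul]
    rw [semiclassicalOp_congr hev, hev.eq_of_nhds]
    simp [semiclassicalOp]
  · rw [mem_closedBall, Real.dist_eq] at hx
    have hxr : (x : ℂ) ∈ ball (x₀ : ℂ) (r / 2) := by rw [mem_ball, hdist]; linarith
    have hx4 : x ∈ ball x₀ (r / 4) := by rw [mem_ball, Real.dist_eq]; linarith
    -- Since `‖Φ'‖ ≤ M`, the phase is at most `M * h` in modulus within distance `h` of `x₀`. So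
    -- `exp (Φ / h)` stays above `exp (-M)` there, and no Gaussian integral is needed.
    have h1 := (convex_ball (x₀ : ℂ) r).norm_image_sub_le_of_norm_hasDerivWithin_le
      (fun y hy => (hΦ y hy).hasDerivWithinAt) hgM (mem_ball_self hr)
      (ball_subset_ball (by linarith) hxr)
    rw [hΦ0, sub_zero, ← dist_eq_norm, hdist] at h1
    have h2 : -M ≤ (Φ x).re / h := by
      rw [le_div_iff₀ hh]
      have h3 := (abs_le.1 (Complex.abs_re_le_norm (Φ x))).1
      have h4 : M * |x - x₀| ≤ M * h := by gcongr
      linarith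
    have h5 : 1 / 2 ≤ ‖u x‖ := by
      have h6 := norm_sub_norm_le (1 : ℂ) (u x)
      rw [norm_one, norm_sub_rev] at h6
      linarith [hu1 x hxr]
    rw [hψ]
    simp only [hχ1 x hx4, one_mul]
    rw [norm_mul, Complex.norm_exp, Complex.div_ofReal_re, div_eq_mul_one_div]
    gcongr

theorem IsPseudomodeFamily.mono {C C' h₀ h₀' : ℝ} {ψ : ℝ → ℝ → ℂ}
    (H : IsPseudomodeFamily a z C h₀ ψ) (hC' : 1 < C') (hC : C' ≤ C) (hh : h₀' ≤ h₀) :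
    IsPseudomodeFamily a z C' h₀' ψ := by
  intro h hpos hle
  obtain ⟨h1, h2⟩ := H h hpos (hle.trans hh)
  refine ⟨h1, h2.trans_le (mul_le_mul_left (ENNReal.ofReal_le_ofReal ?_) _)⟩
  exact Real.rpow_le_rpow_of_nonpos (by linarith) hC
    (div_nonpos_of_nonpos_of_nonneg (by norm_num) hpos.le)

theorem exists_pseudomodes_near {ξ₀ : ℝ} (ha : ∀ j, AnalyticAt ℝ (a j) x₀)
    (hbr : 0 < halfBracket (semiclassicalSymbol a) x₀ ξ₀) :
    ∃ ε C h₀ : ℝ, 0 < ε ∧ 1 < C ∧ 0 < h₀ ∧ ∀ z ∈ ball (semiclassicalSymbol a x₀ ξ₀) ε,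
      ∃ ψ : ℝ → ℝ → ℂ, IsPseudomodeFamily a z C h₀ ψ := by
  obtain ⟨b, G, R, M, c₀, L, hR, hM, hc₀, hL, hb, hbM, hab, hG1, hG0, hG⟩ :=
    exists_phase_family ha hbr
  set z₀ := semiclassicalSymbol a x₀ ξ₀
  have hz₀ : z₀ ∈ ball z₀ R := mem_ball_self hR
  have hx2R : (x₀ : ℂ) ∈ ball (x₀ : ℂ) (2 * R) := mem_ball_self (by positivity)
  obtain ⟨r₀, hr₀, hr₀R, hamp⟩ := exists_wkb_amplitude n hM hR hc₀
  obtain ⟨σ, κ, hσ, hκ, hphase⟩ := exists_re_phase_le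
    ((hG z₀ hz₀).1.differentiableAt (isOpen_ball.mem_nhds hx2R)) hG0 hG1
  set r := min r₀ σ with hrdef
  have hr : 0 < r := lt_min hr₀ hσ
  have hrR : r ≤ R := (min_le_left _ _).trans hr₀R
  obtain ⟨γ, C, h₁, hγ, hC, hh₁, hu⟩ := hamp r hr (min_le_left _ _)
  obtain ⟨χ, hχ, hχc, hχs, hχ1⟩ := exists_cutoff x₀ hr
  -- In the transition zone `κ (x - x₀) ^ 2 ≥ 4 * β`. Moving `z` costs at most `γ' ≤ β`, and passing
  -- to a complex disc of radius `s` at most `M * s ≤ β`, which leaves `Re Φ ≤ -β`.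
  set β := κ * r ^ 2 / 64 with hβ
  have hβ0 : 0 < β := by positivity
  set s := min (r / 16) (β / (M + 1)) with hsdef
  have hs : 0 < s := lt_min (by positivity) (by positivity)
  have hMs : M * s ≤ β := by
    have h1 : s ≤ β / (M + 1) := min_le_right _ _
    rw [le_div_iff₀ (by positivity)] at h1
    nlinarith
  obtain ⟨C₁, hC₁, hχC⟩ := exists_norm_iteratedDeriv_cutoff_mul_le hχ hχc hs n
  set γ' := min (γ / 2) β with hγ'def
  have hγ' : 0 < γ' := lt_min (by positivity) hβ0
  -- For `‖z - z₀‖ < ε` the two phases differ by at most `L * ε * r ≤ γ'` on the disc of radius `r`.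
  set ε := min R (γ' / (L * r + 1)) with hεdef
  have hε : 0 < ε := lt_min hR (by positivity)
  have hLε : L * ε * r ≤ γ' := by
    have h1 : ε ≤ γ' / (L * r + 1) := min_le_right _ _
    rw [le_div_iff₀ (by positivity)] at h1
    nlinarith
  set A := C + ((n + 1) * M + (‖z₀‖ + R)) * (C₁ * (3 / 2)) with hA
  have hA0 : 0 ≤ A := by positivity
  set m := Real.exp (-M) / 2 with hm
  have hm0 : 0 < m := by positivity
  set h₀ := min (min h₁ (min 1 (r / 8)))
    (m ^ 2 * γ' ^ 2 / (4 * (A ^ 2 * (3 * r / 8) + 1))) with hh₀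
  refine ⟨ε, Real.exp (γ' / 2), h₀, hε, Real.one_lt_exp_iff.2 (by positivity), ?_, ?_⟩
  · exact lt_min (lt_min hh₁ (lt_min one_pos (by positivity))) (by positivity)
  intro z hz
  have hzR : z ∈ ball z₀ R := ball_subset_ball (min_le_left _ _) hz
  obtain ⟨hGd, hGz⟩ := hG z hzR
  have hsub : ball (x₀ : ℂ) r ⊆ ball (x₀ : ℂ) (2 * R) := ball_subset_ball (by linarith)
  obtain ⟨Φ₀, hΦ₀0, hΦ₀⟩ := (hG z₀ hz₀).1.isExactOn_ball.with_val_at x₀ 0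
  obtain ⟨Φ, hΦ0, hΦ⟩ := hGd.isExactOn_ball.with_val_at x₀ 0
  have hΦr : ∀ x ∈ ball (x₀ : ℂ) r, HasDerivAt Φ (G z x) x := fun x hx => hΦ x (hsub hx)
  have hdiff : ∀ x ∈ ball (x₀ : ℂ) r, ‖Φ x - Φ₀ x‖ ≤ γ' := by
    intro x hx
    have h1 := (convex_ball (x₀ : ℂ) r).norm_image_sub_le_of_norm_hasDerivWithin_le
      (f := fun y => Φ y - Φ₀ y) (C := L * ε)
      (fun y hy => ((hΦ y (hsub hy)).sub (hΦ₀ y (hsub hy))).hasDerivWithinAt)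
      (fun y hy => ((hGz y (hsub hy)).2.2.2).trans (by
        rw [mem_ball, dist_eq_norm] at hz; gcongr)) (mem_ball_self hr) hx
    rw [hΦ0, hΦ₀0, sub_zero, sub_zero, ← dist_eq_norm x] at h1
    have h2 : dist x (x₀ : ℂ) ≤ r := (mem_ball.1 hx).le
    exact h1.trans (le_trans (by gcongr) hLε)
  have hamp' : ∀ h : ℝ, 0 < h → h ≤ h₀ → ∃ ψ : ℝ → ℂ, IsTestFunction ψ ∧
      MeasureTheory.eLpNorm (fun x => semiclassicalOp a h ψ x - z * ψ x) 2 MeasureTheory.volume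
        < ENNReal.ofReal (Real.exp (γ' / 2) ^ (-1 / h))
          * MeasureTheory.eLpNorm ψ 2 MeasureTheory.volume := by
    intro h hh hhh
    obtain ⟨hhh', hh4⟩ := le_min_iff.1 hhh
    obtain ⟨hh1, hhh''⟩ := le_min_iff.1 hhh'
    obtain ⟨hh2, hh3⟩ := le_min_iff.1 hhh''
    obtain ⟨u, hud, hu1, hures⟩ := hu x₀ b (G z) hb hbM hGd (fun x hx => (hGz x hx).1)
      (fun x hx => (hGz x hx).2.1) h hh hh1
    have hV : DifferentiableOn ℂ (fun y => Complex.exp (Φ y / h) * u y) (ball (x₀ : ℂ) r) :=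
      fun y hy => (((hΦr y hy).div_const (h : ℂ)).cexp.differentiableAt.differentiableWithinAt).mul
        (hud y hy)
    have hre : ∀ x : ℝ, |x - x₀| < r → (Φ x).re ≤ -(κ * (x - x₀) ^ 2) + γ' := by
      intro x hx
      have hxr : (x : ℂ) ∈ ball (x₀ : ℂ) r := by
        rwa [mem_ball, Complex.isometry_ofReal.dist_eq, Real.dist_eq]
      have h1 := hphase Φ₀ r (min_le_right _ _) (fun y hy => hΦ₀ y (hsub hy)) hΦ₀0 x hx
      have h2 := (Complex.re_le_norm _).trans (hdiff x hxr)
      rw [Complex.sub_re] at h2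
      linarith
    have hbd := wkb_cutoff_bounds (a := a) (z := z)
      (ψ := fun x : ℝ => χ x * (Complex.exp (Φ x / h) * u x)) (γ := γ) (β := β) (γ' := γ') (C := C) (C₁ := C₁) (χ := χ) (M := M) hr
      (min_le_left _ _) hs hh hh2 (by linarith)
      (fun j x hx => hab j x (hsub hx)) (fun j x hx => hbM j x (hsub hx)) (hGd.mono hsub)
      (fun x hx => (hGz x (hsub hx)).1) (fun x hx => (hGz x (hsub hx)).2.2.1) hΦr hΦ0
      (fun x hx => ?_) (fun x hx1 hx2 y hy => ?_) hud hu1 hures hχs hχ1 hC₁ hC.le hχC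
      (min_le_left _ _) (min_le_right _ _) rfl
    · refine ⟨_, isTestFunction_mul_comp_ofReal isOpen_ball hV hχ hχc fun x hx => ?_, ?_⟩
      · have := hχs hx
        rw [mem_closedBall] at this
        rw [mem_ball, Complex.isometry_ofReal.dist_eq]
        linarith
      · obtain ⟨hb1, hb2, hb3⟩ := hbd
        have hq : Real.exp (γ' / 2) ^ (-1 / h) = Real.exp (-(γ' / (2 * h))) := by
          rw [← Real.exp_mul]; congr 1; field_simp
        rw [hq]
        refine eLpNorm_two_lt_of_bounds (by positivity) hm0.le (Real.exp_pos _).le (by positivity)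
          (fun x hx => (hb1 x hx).trans ?_) hb2 hb3
          (exp_neg_lt_of_le (by positivity) hγ' hh hh4)
        have hzn : ‖z‖ ≤ ‖z₀‖ + R := by
          rw [mem_ball, dist_eq_norm] at hzR
          linarith [norm_le_norm_add_norm_sub' z z₀]
        rw [hA]
        gcongr
    · have h1 := hre x (by linarith)
      have h2 : 0 ≤ κ * (x - x₀) ^ 2 := by positivity
      have h3 : γ' ≤ γ / 2 := min_le_left _ _
      linarith
    · have h1 := hre x (by linarith)
      have h2 : (r / 4) ^ 2 ≤ (x - x₀) ^ 2 := by
        rw [← sq_abs (x - x₀)]; gcongr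
      have h3 : γ' ≤ β := min_le_right _ _
      have h4 : 4 * β ≤ κ * (x - x₀) ^ 2 := by
        calc 4 * β = κ * (r / 4) ^ 2 := by rw [hβ]; ring
          _ ≤ _ := by gcongr
      have hxs : closedBall (x : ℂ) s ⊆ ball (x₀ : ℂ) r := by
        refine closedBall_subset_ball' ?_
        rw [Complex.isometry_ofReal.dist_eq, Real.dist_eq]
        have : s ≤ r / 16 := min_le_left _ _
        linarith
      have h5 := (convex_ball (x₀ : ℂ) r).norm_image_sub_le_of_norm_hasDerivWithin_le
        (fun w hw => (hΦr w hw).hasDerivWithinAt) (fun w hw => (hGz w (hsub hw)).1)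
        (hxs (mem_closedBall_self hs.le)) (hxs hy)
      rw [mem_closedBall, dist_eq_norm] at hy
      have h6 : M * ‖y - x‖ ≤ M * s := by gcongr
      have h7 := Complex.re_le_norm (Φ y - Φ x)
      rw [Complex.sub_re] at h7
      linarith
  choose! ψ hψ using hamp'
  exact ⟨ψ, hψ⟩

end Pseudomode

theorem mainTheorem5 (n : ℕ) (a : Fin (n + 1) → ℝ → ℂ)
    (ha : ∀ j, AnalyticOnNhd ℝ (a j) Set.univ) :
    (∀ z ∈ pseudospectrumCore a, ∃ C h₀ : ℝ, 1 < C ∧ 0 < h₀ ∧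
      ∃ ψ : ℝ → ℝ → ℂ, IsPseudomodeFamily a z C h₀ ψ) ∧
    (∀ K : Set ℂ, IsCompact K → K ⊆ pseudospectrumCore a →
      ∃ C h₀ : ℝ, 1 < C ∧ 0 < h₀ ∧
        ∀ z ∈ K, ∃ ψ : ℝ → ℝ → ℂ, IsPseudomodeFamily a z C h₀ ψ) := by
  have near : ∀ z ∈ pseudospectrumCore a, ∃ ε C h₀ : ℝ, 0 < ε ∧ 1 < C ∧ 0 < h₀ ∧
      ∀ w ∈ ball z ε, ∃ ψ : ℝ → ℝ → ℂ, IsPseudomodeFamily a w C h₀ ψ := by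
    rintro _ ⟨x, ξ, hpos, rfl⟩
    exact exists_pseudomodes_near (fun j => ha j x (Set.mem_univ x)) hpos
  refine ⟨fun z hz => ?_, fun K hK hKΛ => ?_⟩
  · obtain ⟨ε, C, h₀, hε, hC, hh₀, hψ⟩ := near z hz
    exact ⟨C, h₀, hC, hh₀, hψ z (mem_ball_self hε)⟩
  -- Local uniformity extends to `K` by compactness; a union takes the minimum of the constants.
  refine hK.induction_on (p := fun S => ∃ C h₀ : ℝ, 1 < C ∧ 0 < h₀ ∧
    ∀ z ∈ S, ∃ ψ : ℝ → ℝ → ℂ, IsPseudomodeFamily a z C h₀ ψ) ?_ ?_ ?_ ?_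
  · exact ⟨2, 1, one_lt_two, one_pos, fun z hz => hz.elim⟩
  · rintro S T hST ⟨C, h₀, hC, hh₀, hψ⟩
    exact ⟨C, h₀, hC, hh₀, fun z hz => hψ z (hST hz)⟩
  · rintro S T ⟨C, h₀, hC, hh₀, hψ⟩ ⟨C', h₀', hC', hh₀', hψ'⟩
    refine ⟨min C C', min h₀ h₀', lt_min hC hC', lt_min hh₀ hh₀', ?_⟩
    rintro z (hz | hz)
    · obtain ⟨ψ, H⟩ := hψ z hz
      exact ⟨ψ, H.mono (lt_min hC hC') (min_le_left _ _) (min_le_left _ _)⟩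
    · obtain ⟨ψ, H⟩ := hψ' z hz
      exact ⟨ψ, H.mono (lt_min hC hC') (min_le_right _ _) (min_le_right _ _)⟩
  · intro z hz
    obtain ⟨ε, C, h₀, hε, hC, hh₀, hψ⟩ := near z (hKΛ hz)
    exact ⟨ball z ε, mem_nhdsWithin_of_mem_nhds (ball_mem_nhds z hε), C, h₀, hC, hh₀, hψ⟩
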